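/- Let $M$ be a connected smooth manifold (Hausdorff, second countable, finite-dimensional, without boundary) and let $\omega$ be a 2-plectic form on $M$, i.e. a closed 3-form such that $v\mapsto\iota_v\omega$ is injective on every tangent space. Write $\iota(v\wedge w)\omega=\omega(v,w,\cdot)$ and $\iota(u\wedge v\wedge w)\omega=\omega(u,v,w)$. A vector field $v$ is Hamiltonian if there is a 1-form $\alpha$ with $d\alpha=-\iota_v\omega$; such an $\alpha$ is called a Hamiltonian 1-form with Hamiltonian vector field $v_\alpha=v$, and $\Omega^1_{\rm Ham}(M)$ is the space of these forms. A Lie 2-algebra is an $L_\infty$-algebra concentrated in degrees $0,-1$. Let $L_\infty(M,\omega)$ be the Lie 2-algebra with $\Omega^1_{\rm Ham}(M)$ in degree $0$, $C^\infty(M)$ in degree $-1$, unary bracket $d$, binary bracket $[\alpha,\beta]'=\omega(v_\alpha,v_\beta,\cdot)$ and ternary bracket $[\alpha,\beta,\gamma]'=-\omega(v_\alpha,v_\beta,v_\gamma)$ on degree $0$ elements, all other brackets being zero. For a Lie algebra $\mathfrak k$ acting on $M$ through a Lie algebra morphism $x\mapsto v_x$ and a Lie 2-algebra whose degree $0$ part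 is $\mathfrak k$ with its Lie bracket, a moment map is an $L_\infty$-morphism $F=(F_1,F_2)$ from this Lie 2-algebra to $L_\infty(M,\omega)$ with $-\iota_{v_x}\omega=d(F_1(x))$ for all $x\in\mathfrak k$. For a real Lie algebra 3-cocycle $c$ on $\mathfrak k$ let $\mathbb R[1]\oplus_c\mathfrak k$ be the Lie 2-algebra with binary bracket the Lie bracket of $\mathfrak k$, ternary bracket $c$, and all other brackets zero. Let $\mathfrak g$ be a real Lie algebra and $\mathfrak g\to\mathfrak X(M)$, $x\mapsto v_x$, a Lie algebra morphism taking values in Hamiltonian vector fields. Let $H^1(M)$ be the first de Rham cohomology of $M$, viewed as a trivial representation of $\mathfrak g$. There exist linear maps $\alpha\colon\mathfrak g\to\Omega^1_{\rm Ham}(M)$ with $d\alpha_x=-\iota_{v_x}\omega$ for all $x$. For such $\alpha$ the forms $\alpha_{[x,y]}-\iota(v_x\wedge v_y)\omega$ are closed; put $B_\alpha(x,y)=[\alpha_{[x,y]}-\iota(v_x\wedge v_y)\omega]\in H^1(M)$. Then: (i) Each $B_\alpha$ is a Lie algebra 2-cocycle of $\mathfrak g$ with values in $H^1(M)$, so that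 $\mathfrak g\oplus H^1(M)$ with the bracket $[(x_1,A_1),(x_2,A_2)]=([x_1,x_2],B_\alpha(x_1,x_2))$ is a central extension of $\mathfrak g$ by $H^1(M)$. For two choices $\alpha,\alpha'$ one has $B_\alpha-B_{\alpha'}=-d_{\mathfrak g}[\alpha-\alpha']$, where $d_{\mathfrak g}$ is the Chevalley–Eilenberg differential, and there is an isomorphism between the two extensions that is the identity on $H^1(M)$ and on $\mathfrak g$. (ii) Let $p\in M$. Then $\omega_{3p}(x,y,z)=\omega(v_x,v_y,v_z)|_p$ is a Lie algebra 3-cocycle on $\mathfrak g$, $-\omega_{3p}$ (composed with the projection to $\mathfrak g$) is a 3-cocycle on $\mathfrak g\oplus H^1(M)$ for every $\alpha$, and there is a moment map for the Lie 2-algebra $\mathbb R[1]\oplus_{-\omega_{3p}}(\mathfrak g\oplus H^1(M))$, where $\mathfrak g\oplus H^1(M)$ acts on $M$ through the projection to $\mathfrak g$. Explicitly, linear maps $\psi$ from $H^1(M)$ to the closed 1-forms that assign a representative to each class exist, and for each of them there is exactly one moment map $F$ such that $F_1(x+A)=\alpha_x-\psi(A)$ for $x\in\mathfrak g$, $A\in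 H^1(M)$; $F_1(r)=r$ (the constant function) for $r\in\mathbb R$; and $F_2(x_1+A_1,x_2+A_2)$ is the function vanishing at $p$ with differential $\alpha_{[x_1,x_2]}-\iota(v_{x_1}\wedge v_{x_2})\omega-\psi(B_\alpha(x_1,x_2))$. -/

import Mathlib

open scoped Manifold ContDiff Topology

noncomputable section

namespace Multisymplectic

section Local
open VectorField
variable {E : Type*} [NormedAddCommGroup E] [NormedSpace ℝ E]

lemma koszul1 {η : E → E [⋀^Fin 1]→L[ℝ] ℝ} {y : E} (h : DifferentiableAt ℝ η y) {U V : E → E}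
    (hU : DifferentiableAt ℝ U y) (hV : DifferentiableAt ℝ V y) :
    extDeriv η y ![U y, V y] = fderiv ℝ (fun z => η z ![V z]) y (U y)
      - fderiv ℝ (fun z => η z ![U z]) y (V y) - η y ![lieBracket ℝ U V y] := by
  have key := extDeriv_apply_vectorField h (V := ![U, V])
    (by intro i; fin_cases i <;> assumption)
  have e : ∀ z, (fun i => (![U, V] i) z) = ![U z, V z] := by
    intro z; ext i; fin_cases i <;> rfl
  have r0 : ∀ z, Fin.removeNth 0 ![U z, V z] = ![V z] := by
    intro z; ext i; fin_cases i; rfl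
  have r1 : ∀ z, Fin.removeNth 1 ![U z, V z] = ![U z] := by
    intro z; ext i; fin_cases i; rfl
  simp only [e] at key
  rw [key, Fin.sum_univ_two, Fin.sum_univ_one, show Finset.Ici (0 : Fin 1) = {0} from rfl,
    Finset.sum_singleton]
  simp only [r0, r1]
  simp [Subsingleton.elim (Fin.removeNth (0 : Fin 1) ![V y]) ![]]
  ring

lemma koszul2 {η : E → E [⋀^Fin 2]→L[ℝ] ℝ} {y : E} (h : DifferentiableAt ℝ η y) {U V W : E → E}
    (hU : DifferentiableAt ℝ U y) (hV : DifferentiableAt ℝ V y) (hW : DifferentiableAt ℝ W y) :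
    extDeriv η y ![U y, V y, W y] = fderiv ℝ (fun z => η z ![V z, W z]) y (U y)
      - fderiv ℝ (fun z => η z ![U z, W z]) y (V y) + fderiv ℝ (fun z => η z ![U z, V z]) y (W y)
       - η y ![lieBracket ℝ U V y, W y] + η y ![lieBracket ℝ U W y, V y]
       - η y ![lieBracket ℝ V W y, U y] := by
  have key := extDeriv_apply_vectorField h (V := ![U, V, W])
    (by intro i; fin_cases i <;> assumption)
  have e : ∀ z, (fun i => (![U, V, W] i) z) = ![U z, V z, W z] := by
    intro z; ext i; fin_cases i <;> rfl
  have r0 : ∀ a b c : E, Fin.removeNth 0 ![a, b, c] = ![b, c] := by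
    intro a b c; ext i; fin_cases i <;> rfl
  have r1 : ∀ a b c : E, Fin.removeNth 1 ![a, b, c] = ![a, c] := by
    intro a b c; ext i; fin_cases i <;> rfl
  have r2 : ∀ a b c : E, Fin.removeNth 2 ![a, b, c] = ![a, b] := by
    intro a b c; ext i; fin_cases i <;> rfl
  have s0 : ∀ a b : E, Fin.removeNth 0 ![a, b] = ![b] := by
    intro a b; ext i; fin_cases i; rfl
  have s1 : ∀ a b : E, Fin.removeNth 1 ![a, b] = ![a] := by
    intro a b; ext i; fin_cases i; rfl
  simp only [e] at key
  rw [key, Fin.sum_univ_three, Fin.sum_univ_two,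
    show Finset.Ici (0 : Fin 2) = {0, 1} from rfl, show Finset.Ici (1 : Fin 2) = {1} from rfl,
    Finset.sum_pair (by decide), Finset.sum_singleton]
  simp only [r0, r1, r2, s0, s1, Fin.castSucc_zero, show Fin.castSucc (1 : Fin 2) = 1 from rfl,
    show Fin.succ (1 : Fin 2) = 2 from rfl, show Fin.succ (0 : Fin 2) = 1 from rfl]
  simp
  ring

lemma koszul3 {η : E → E [⋀^Fin 3]→L[ℝ] ℝ} {y : E} (h : DifferentiableAt ℝ η y)
    {U V W X : E → E} (hU : DifferentiableAt ℝ U y) (hV : DifferentiableAt ℝ V y)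
    (hW : DifferentiableAt ℝ W y) (hX : DifferentiableAt ℝ X y) :
    extDeriv η y ![U y, V y, W y, X y] = fderiv ℝ (fun z => η z ![V z, W z, X z]) y (U y)
      - fderiv ℝ (fun z => η z ![U z, W z, X z]) y (V y)
      + fderiv ℝ (fun z => η z ![U z, V z, X z]) y (W y)
      - fderiv ℝ (fun z => η z ![U z, V z, W z]) y (X y)
      - η y ![lieBracket ℝ U V y, W y, X y] + η y ![lieBracket ℝ U W y, V y, X y]
      - η y ![lieBracket ℝ U X y, V y, W y] - η y ![lieBracket ℝ V W y, U y, X y]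
      + η y ![lieBracket ℝ V X y, U y, W y] - η y ![lieBracket ℝ W X y, U y, V y] := by
  have key := extDeriv_apply_vectorField h (V := ![U, V, W, X])
    (by intro i; fin_cases i <;> assumption)
  have e : ∀ z, (fun i => (![U, V, W, X] i) z) = ![U z, V z, W z, X z] := by
    intro z; ext i; fin_cases i <;> rfl
  have t0 : ∀ a b c d : E, Fin.removeNth 0 ![a, b, c, d] = ![b, c, d] := by
    intro a b c d; ext i; fin_cases i <;> rfl
  have t1 : ∀ a b c d : E, Fin.removeNth 1 ![a, b, c, d] = ![a, c, d] := by
    intro a b c d; ext i; fin_cases i <;> rfl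
  have t2 : ∀ a b c d : E, Fin.removeNth 2 ![a, b, c, d] = ![a, b, d] := by
    intro a b c d; ext i; fin_cases i <;> rfl
  have t3 : ∀ a b c d : E, Fin.removeNth 3 ![a, b, c, d] = ![a, b, c] := by
    intro a b c d; ext i; fin_cases i <;> rfl
  have r0 : ∀ a b c : E, Fin.removeNth 0 ![a, b, c] = ![b, c] := by
    intro a b c; ext i; fin_cases i <;> rfl
  have r1 : ∀ a b c : E, Fin.removeNth 1 ![a, b, c] = ![a, c] := by
    intro a b c; ext i; fin_cases i <;> rfl
  have r2 : ∀ a b c : E, Fin.removeNth 2 ![a, b, c] = ![a, b] := by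
    intro a b c; ext i; fin_cases i <;> rfl
  simp only [e] at key
  rw [key, Fin.sum_univ_four, Fin.sum_univ_three,
    show Finset.Ici (0 : Fin 3) = {0, 1, 2} from rfl,
    show Finset.Ici (1 : Fin 3) = {1, 2} from rfl, show Finset.Ici (2 : Fin 3) = {2} from rfl,
    Finset.sum_insert (by decide), Finset.sum_pair (by decide), Finset.sum_pair (by decide),
    Finset.sum_singleton]
  simp only [t0, t1, t2, t3, r0, r1, r2, Fin.castSucc_zero,
    show Fin.castSucc (1 : Fin 3) = 1 from rfl, show Fin.castSucc (2 : Fin 3) = 2 from rfl,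
    show Fin.succ (2 : Fin 3) = 3 from rfl,
    show Fin.succ (1 : Fin 3) = 2 from rfl, show Fin.succ (0 : Fin 3) = 1 from rfl]
  simp
  ring

/-- Contraction of a form on a normed space with a vector field. -/
def contrL {k : ℕ} (V : E → E) (η : E → E [⋀^Fin (k + 1)]→L[ℝ] ℝ) :
    E → E [⋀^Fin k]→L[ℝ] ℝ := fun y => (η y).curryLeft (V y)

lemma contrL_apply {k : ℕ} (V : E → E) (η : E → E [⋀^Fin (k + 1)]→L[ℝ] ℝ) (y : E)
    (m : Fin k → E) : contrL V η y m = η y (Matrix.vecCons (V y) m) := rfl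

lemma contDiffAt_contrL {k : ℕ} {n : WithTop ℕ∞} {V : E → E} {η : E → E [⋀^Fin (k + 1)]→L[ℝ] ℝ}
    {y : E} (hη : ContDiffAt ℝ n η y) (hV : ContDiffAt ℝ n V y) :
    ContDiffAt ℝ n (contrL V η) y :=
  ContDiffAt.clm_apply (f := fun z => (ContinuousAlternatingMap.curryLeftLI (𝕜 := ℝ) (E := E)
    (F := ℝ) (n := k)) (η z)) ((LinearIsometry.contDiff _).contDiffAt.comp y hη) hV

lemma alt_swap01 (f : E [⋀^Fin 3]→L[ℝ] ℝ) (a b c : E) : f ![a, b, c] = -f ![b, a, c] := by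
  have := f.toAlternatingMap.map_swap ![b, a, c] (i := 0) (j := 1) (by decide)
  rw [← f.coe_toAlternatingMap, ← this]
  congr 1; ext i; fin_cases i <;> rfl

lemma alt_swap12 (f : E [⋀^Fin 3]→L[ℝ] ℝ) (a b c : E) : f ![a, b, c] = -f ![a, c, b] := by
  have := f.toAlternatingMap.map_swap ![a, c, b] (i := 1) (j := 2) (by decide)
  rw [← f.coe_toAlternatingMap, ← this]
  congr 1; ext i; fin_cases i <;> rfl

lemma local_bracket {η : E → E [⋀^Fin 3]→L[ℝ] ℝ} {y : E} (h : ContDiffAt ℝ ∞ η y) {V W : E → E}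
    (hV : ContDiffAt ℝ ∞ V y) (hW : ContDiffAt ℝ ∞ W y) (h0 : extDeriv η y = 0)
    (hV0 : extDeriv (contrL V η) y = 0) (hW0 : extDeriv (contrL W η) y = 0) :
    extDeriv (contrL W (contrL V η)) y = - contrL (lieBracket ℝ V W) η y := by
  have dV := hV.differentiableAt (by simp)
  have dW := hW.differentiableAt (by simp)
  ext m
  obtain ⟨a, b, rfl⟩ : ∃ a b, m = ![a, b] := ⟨m 0, m 1, by ext i; fin_cases i <;> rfl⟩
  have da : DifferentiableAt ℝ (fun _ : E => a) y := by fun_prop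
  have db : DifferentiableAt ℝ (fun _ : E => b) y := by fun_prop
  have dη := h.differentiableAt (by simp)
  have dVη := (contDiffAt_contrL h hV).differentiableAt (by simp)
  have dWη := (contDiffAt_contrL h hW).differentiableAt (by simp)
  have dWVη := (contDiffAt_contrL (contDiffAt_contrL h hV) hW).differentiableAt (by simp)
  have k1 := koszul3 dη dV dW da db
  have k2 := koszul2 dVη dW da db
  have k3 := koszul2 dWη dV da db
  have k4 := koszul1 dWVη da db
  rw [h0] at k1
  rw [hV0] at k2
  rw [hW0] at k3
  have z0 : lieBracket ℝ (fun _ : E => a) (fun _ : E => b) y = 0 := by simp [lieBracket]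
  have zz : ∀ c d : E, η y ![0, c, d] = 0 := fun c d => (η y).map_coord_zero 0 rfl
  have zz' : ∀ c d : E, η y ![c, 0, d] = 0 := fun c d => (η y).map_coord_zero 1 rfl
  have zz'' : ∀ c d : E, η y ![c, d, 0] = 0 := fun c d => (η y).map_coord_zero 2 rfl
  simp only [contrL_apply, z0, zz, zz', zz'', ContinuousAlternatingMap.coe_zero, Pi.zero_apply] at k1 k2 k3 k4
  have sf : ∀ c : E, (fun z => η z ![W z, V z, c]) = fun z => -η z ![V z, W z, c] := by
    intro c; ext z; exact alt_swap01 _ _ _ _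
  simp only [sf, fderiv_fun_neg, _root_.neg_apply] at k3
  rw [k4, ContinuousAlternatingMap.coe_neg, Pi.neg_apply, contrL_apply]
  rw [alt_swap01 (η y) (lieBracket ℝ V (fun _ => a) y), alt_swap01 (η y) (lieBracket ℝ V (fun _ => b) y),
    alt_swap01 (η y) (lieBracket ℝ W (fun _ => a) y), alt_swap01 (η y) (lieBracket ℝ W (fun _ => b) y)] at k1
  linarith

/-- Contracting three Hamiltonian vector fields with a closed 3-form. -/
lemma local_jac {η : E → E [⋀^Fin 3]→L[ℝ] ℝ} {y : E} (h : ContDiffAt ℝ ∞ η y) {U V W : E → E}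
    (hU : ContDiffAt ℝ ∞ U y) (hV : ContDiffAt ℝ ∞ V y) (hW : ContDiffAt ℝ ∞ W y)
    (h0 : extDeriv η y = 0) (hU0 : extDeriv (contrL U η) y = 0)
    (hV0 : extDeriv (contrL V η) y = 0) (hW0 : extDeriv (contrL W η) y = 0) (a : E) :
    fderiv ℝ (fun z => η z ![U z, V z, W z]) y a =
      - (η y ![U y, lieBracket ℝ V W y, a] + η y ![V y, lieBracket ℝ W U y, a]
        + η y ![W y, lieBracket ℝ U V y, a]) := by
  have dU := hU.differentiableAt (by simp)
  have dV := hV.differentiableAt (by simp)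
  have dW := hW.differentiableAt (by simp)
  have da : DifferentiableAt ℝ (fun _ : E => a) y := by fun_prop
  have dη := h.differentiableAt (by simp)
  have key : ∀ {U V W : E → E}, ContDiffAt ℝ ∞ U y → ContDiffAt ℝ ∞ V y → ContDiffAt ℝ ∞ W y →
      extDeriv (contrL U η) y = 0 → extDeriv (contrL V η) y = 0 →
      - η y ![lieBracket ℝ U V y, W y, a] = fderiv ℝ (fun z => η z ![U z, V z, a]) y (W y)
        - fderiv ℝ (fun z => η z ![U z, V z, W z]) y a
        - η y ![U y, V y, lieBracket ℝ W (fun _ => a) y] := by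
    intro U V W hU hV hW hU0 hV0
    have k := koszul1 ((contDiffAt_contrL (contDiffAt_contrL h hU) hV).differentiableAt (by simp))
      (hW.differentiableAt (by simp)) da
    rw [local_bracket h hU hV h0 hU0 hV0] at k
    exact k
  have k1 := koszul3 dη dU dV dW da
  have e1 := key hU hV hW hU0 hV0
  have e2 := key hV hW hU hV0 hW0
  have e3 := key hW hU hV hW0 hU0
  rw [h0] at k1
  simp only [ContinuousAlternatingMap.coe_zero, Pi.zero_apply] at k1
  have s1 : (fun z => η z ![W z, U z, a]) = fun z => -η z ![U z, W z, a] := by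
    ext z; exact alt_swap01 _ _ _ _
  have s2 : (fun z => η z ![V z, W z, U z]) = fun z => η z ![U z, V z, W z] := by
    ext z; rw [alt_swap12, alt_swap01, neg_neg]
  have s3 : (fun z => η z ![W z, U z, V z]) = fun z => η z ![U z, V z, W z] := by
    ext z; rw [alt_swap01, alt_swap12, neg_neg]
  rw [s2] at e2
  simp only [s1, s3, fderiv_fun_neg, _root_.neg_apply] at e3
  have b1 : lieBracket ℝ W U y = - lieBracket ℝ U W y := lieBracket_swap
  have n1 : ∀ p q r : E, η y ![-p, q, r] = - η y ![p, q, r] := fun p q r => by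
    simpa using (η y).vecCons_smul ![q, r] (-1) p
  rw [alt_swap01 _ (U y) (lieBracket ℝ V W y), alt_swap01 _ (V y) (lieBracket ℝ W U y),
    alt_swap01 _ (W y) (lieBracket ℝ U V y)]
  rw [b1, n1] at e3 ⊢
  have c1 : ∀ p q r : E, η y ![p, q, r] = η y ![q, r, p] := fun p q r => by
    rw [alt_swap01, alt_swap12, neg_neg]
  rw [c1 (lieBracket ℝ U (fun _ => a) y), c1 (lieBracket ℝ V (fun _ => a) y),
    c1 (lieBracket ℝ W (fun _ => a) y), alt_swap01 _ (U y) (W y)] at k1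
  linarith

/-- The invariant 3-cochain given by three Hamiltonian vector fields is a cocycle. -/
lemma local_four {η : E → E [⋀^Fin 3]→L[ℝ] ℝ} {y : E} (h : ContDiffAt ℝ ∞ η y) {U V W X : E → E}
    (hU : ContDiffAt ℝ ∞ U y) (hV : ContDiffAt ℝ ∞ V y) (hW : ContDiffAt ℝ ∞ W y)
    (hX : ContDiffAt ℝ ∞ X y)
    (h0 : extDeriv η y = 0) (hU0 : extDeriv (contrL U η) y = 0)
    (hV0 : extDeriv (contrL V η) y = 0) (hW0 : extDeriv (contrL W η) y = 0)
    (hX0 : extDeriv (contrL X η) y = 0) :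
    η y ![lieBracket ℝ U V y, W y, X y] - η y ![lieBracket ℝ U W y, V y, X y]
      + η y ![lieBracket ℝ U X y, V y, W y] + η y ![lieBracket ℝ V W y, U y, X y]
      - η y ![lieBracket ℝ V X y, U y, W y] + η y ![lieBracket ℝ W X y, U y, V y] = 0 := by
  have k := koszul3 (h.differentiableAt (by simp)) (hU.differentiableAt (by simp))
    (hV.differentiableAt (by simp)) (hW.differentiableAt (by simp)) (hX.differentiableAt (by simp))
  rw [h0, local_jac h hV hW hX h0 hV0 hW0 hX0, local_jac h hU hW hX h0 hU0 hW0 hX0,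
    local_jac h hU hV hX h0 hU0 hV0 hX0, local_jac h hU hV hW h0 hU0 hV0 hW0] at k
  simp only [ContinuousAlternatingMap.coe_zero, Pi.zero_apply] at k
  have n1 : ∀ p q r : E, η y ![p, -q, r] = - η y ![p, q, r] := fun p q r => by
    rw [alt_swap01, alt_swap01 _ p q]
    congr 1
    simpa using (η y).vecCons_smul ![p, r] (-1) q
  have b1 : lieBracket ℝ X V y = - lieBracket ℝ V X y := lieBracket_swap
  have b2 : lieBracket ℝ X U y = - lieBracket ℝ U X y := lieBracket_swap
  have b3 : lieBracket ℝ W U y = - lieBracket ℝ U W y := lieBracket_swap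
  simp only [b1, b2, b3, n1] at k
  have c : ∀ p q r : E, η y ![p, q, r] = - η y ![q, p, r] := alt_swap01 _
  have d : ∀ p q r : E, η y ![p, q, r] = - η y ![p, r, q] := alt_swap12 _
  linarith [c (U y) (lieBracket ℝ W X y) (V y), d (lieBracket ℝ W X y) (U y) (V y),
    c (V y) (lieBracket ℝ W X y) (U y), d (lieBracket ℝ W X y) (V y) (U y),
    c (U y) (lieBracket ℝ V X y) (W y), d (lieBracket ℝ V X y) (U y) (W y),
    c (W y) (lieBracket ℝ V X y) (U y), d (lieBracket ℝ V X y) (W y) (U y),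
    c (U y) (lieBracket ℝ V W y) (X y), d (lieBracket ℝ V W y) (U y) (X y),
    c (X y) (lieBracket ℝ V W y) (U y), d (lieBracket ℝ V W y) (X y) (U y),
    c (V y) (lieBracket ℝ U X y) (W y), d (lieBracket ℝ U X y) (V y) (W y),
    c (W y) (lieBracket ℝ U X y) (V y), d (lieBracket ℝ U X y) (W y) (V y),
    c (V y) (lieBracket ℝ U W y) (X y), d (lieBracket ℝ U W y) (V y) (X y),
    c (X y) (lieBracket ℝ U W y) (V y), d (lieBracket ℝ U W y) (X y) (V y),
    c (W y) (lieBracket ℝ U V y) (X y), d (lieBracket ℝ U V y) (W y) (X y),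
    c (X y) (lieBracket ℝ U V y) (W y), d (lieBracket ℝ U V y) (X y) (W y)]
end Local

section Forms
set_option linter.unusedSectionVars false
open VectorField Set
variable (E : Type*) [NormedAddCommGroup E] [NormedSpace ℝ E]
  (M : Type*) [TopologicalSpace M] [ChartedSpace E M]

/-- The space `C^∞(M)` of smooth real functions. -/
abbrev SmoothFun := C^∞⟮𝓘(ℝ, E), M; ℝ⟯

/-- The space `𝔛(M)` of smooth vector fields. -/
abbrev SmoothVF [IsManifold 𝓘(ℝ, E) ∞ M] :=
  Cₛ^∞⟮𝓘(ℝ, E); E, (TangentSpace 𝓘(ℝ, E) : M → Type _)⟯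

/-- A (not necessarily continuous) differential `k`-form: an alternating form on each tangent
space. -/
def RawForm (k : ℕ) := ∀ x : M, TangentSpace 𝓘(ℝ, E) x [⋀^Fin k]→L[ℝ] ℝ

instance (k : ℕ) : AddCommGroup (RawForm E M k) :=
  inferInstanceAs (AddCommGroup (∀ x : M, TangentSpace 𝓘(ℝ, E) x [⋀^Fin k]→L[ℝ] ℝ))
instance (k : ℕ) : Module ℝ (RawForm E M k) :=
  inferInstanceAs (Module ℝ (∀ x : M, TangentSpace 𝓘(ℝ, E) x [⋀^Fin k]→L[ℝ] ℝ))

variable {E M}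

/-- The coordinate expression of a form in the preferred chart at `x₀`: its pullback under the
inverse of the chart. -/
def chartRep {k : ℕ} (η : RawForm E M k) (x₀ : M) : E → E [⋀^Fin k]→L[ℝ] ℝ := fun y =>
  (η ((extChartAt 𝓘(ℝ, E) x₀).symm y)).compContinuousLinearMap
    (mfderiv 𝓘(ℝ, E) 𝓘(ℝ, E) (extChartAt 𝓘(ℝ, E) x₀).symm y ∘L
      (NormedSpace.fromTangentSpace (𝕜 := ℝ) y).symm.toContinuousLinearMap)

/-- Smoothness of a form: around each point, the coordinate expression is smooth. -/
def IsSmoothForm {k : ℕ} (η : RawForm E M k) : Prop :=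
  ∀ x : M, ContDiffAt ℝ ∞ (chartRep η x) (extChartAt 𝓘(ℝ, E) x x)

/-- The exterior derivative, computed in the preferred chart at each point. -/
def extDer {k : ℕ} (η : RawForm E M k) : RawForm E M (k + 1) := fun x =>
  (extDeriv (chartRep η x) (extChartAt 𝓘(ℝ, E) x x)).compContinuousLinearMap
    (mvfderiv 𝓘(ℝ, E) (extChartAt 𝓘(ℝ, E) x) x)

/-- The contraction `ι_V η`, inserting `V` in the first slot. -/
def contract {k : ℕ} (V : ∀ x : M, TangentSpace 𝓘(ℝ, E) x) (η : RawForm E M (k + 1)) :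
    RawForm E M k := fun x =>
  { (η x).toAlternatingMap.curryLeft (V x) with
    cont := (η x).cont.comp (continuous_const.finCons continuous_id) }

/-- The differential of a function, as a 1-form. -/
def dFun (f : M → ℝ) : RawForm E M 1 := fun x =>
  .ofSubsingleton ℝ _ _ 0 (mvfderiv 𝓘(ℝ, E) f x)

lemma contract_apply {k : ℕ} (V : ∀ x : M, TangentSpace 𝓘(ℝ, E) x) (η : RawForm E M (k + 1))
    (x : M) (m : Fin k → TangentSpace 𝓘(ℝ, E) x) :
    contract V η x m = η x (Matrix.vecCons (V x) m) := rfl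

lemma dFun_apply (f : M → ℝ) (x : M) (m : Fin 1 → TangentSpace 𝓘(ℝ, E) x) :
    dFun f x m = mvfderiv 𝓘(ℝ, E) f x (m 0) := rfl

/-- The coordinate expression of a vector field. -/
def vfRep (V : ∀ x : M, TangentSpace 𝓘(ℝ, E) x) (x₀ : M) : E → E := fun y =>
  NormedSpace.fromTangentSpace (𝕜 := ℝ) y
    (mpullbackWithin 𝓘(ℝ, E) 𝓘(ℝ, E) (extChartAt 𝓘(ℝ, E) x₀).symm V (range 𝓘(ℝ, E)) y)

lemma chartRep_add {k : ℕ} (η θ : RawForm E M k) (x₀ : M) :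
    chartRep (η + θ) x₀ = chartRep η x₀ + chartRep θ x₀ := rfl

lemma chartRep_smul {k : ℕ} (c : ℝ) (η : RawForm E M k) (x₀ : M) :
    chartRep (c • η) x₀ = c • chartRep η x₀ := rfl

variable [IsManifold 𝓘(ℝ, E) ∞ M]

lemma extDer_apply {k : ℕ} (η : RawForm E M k) (x : M)
    (m : Fin (k + 1) → TangentSpace 𝓘(ℝ, E) x) :
    extDer η x m = extDeriv (chartRep η x) (extChartAt 𝓘(ℝ, E) x x) m := by
  unfold extDer mvfderiv
  rw [ContinuousAlternatingMap.compContinuousLinearMap_apply, mfderiv_extChartAt_self]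
  rfl

lemma extDer_eq_zero_iff {k : ℕ} (η : RawForm E M k) (x : M) :
    extDer η x = 0 ↔ extDeriv (chartRep η x) (extChartAt 𝓘(ℝ, E) x x) = 0 := by
  constructor
  · intro h
    ext m
    exact (extDer_apply η x m).symm.trans (by rw [h]; rfl)
  · intro h
    ext m
    exact (extDer_apply η x m).trans (by rw [h]; rfl)

lemma chartRep_apply {k : ℕ} (η : RawForm E M k) (x : M) (y : E) (m : Fin k → E) :
    chartRep η x y m = η ((extChartAt 𝓘(ℝ, E) x).symm y) (fun i =>
      mfderivWithin 𝓘(ℝ, E) 𝓘(ℝ, E) (extChartAt 𝓘(ℝ, E) x).symm (range 𝓘(ℝ, E)) y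
        ((NormedSpace.fromTangentSpace (𝕜 := ℝ) y).symm (m i))) := by
  rw [𝓘(ℝ, E).range_eq_univ, mfderivWithin_univ]
  rfl

lemma chartRep_self {k : ℕ} (η : RawForm E M k) (x : M) (m : Fin k → E) :
    chartRep η x (extChartAt 𝓘(ℝ, E) x x) m = η x m := by
  rw [chartRep_apply, mfderivWithin_range_extChartAt_symm]
  have : ∀ z (h : z = x), (η z (fun i => (m i : E))) = η x m := by
    rintro z rfl; rfl
  exact this _ (extChartAt_to_inv x)

lemma chartRep_vfRep {k : ℕ} (η : RawForm E M k) (x : M) {y : E}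
    (hy : y ∈ (extChartAt 𝓘(ℝ, E) x).target) (V : Fin k → ∀ z : M, TangentSpace 𝓘(ℝ, E) z) :
    chartRep η x y (fun i => vfRep (V i) x y) =
      η ((extChartAt 𝓘(ℝ, E) x).symm y) (fun i => V i _) := by
  rw [chartRep_apply]
  congr 1
  ext i
  simp only [vfRep, ContinuousLinearEquiv.symm_apply_apply]
  rw [mpullbackWithin_apply, (isInvertible_mfderivWithin_extChartAt_symm hy).self_apply_inverse]

lemma vfRep_self (V : ∀ z : M, TangentSpace 𝓘(ℝ, E) z) (x : M) :
    vfRep V x (extChartAt 𝓘(ℝ, E) x x) = V x := by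
  have e : ∀ z (_ : z = x), ((V z : E)) = V x := by
    rintro z rfl; rfl
  exact (congrArg (fun w : E => ((mfderivWithin 𝓘(ℝ, E) 𝓘(ℝ, E) (extChartAt 𝓘(ℝ, E) x).symm
    (range 𝓘(ℝ, E)) (extChartAt 𝓘(ℝ, E) x x)).inverse w : E)) (e _ (extChartAt_to_inv x))).trans
    (mfderivWithin_extChartAt_symm_inverse_apply (I := 𝓘(ℝ, E)) (V x))

lemma chartRep_contract {k : ℕ} (η : RawForm E M (k + 1)) (x : M)
    (V : ∀ z : M, TangentSpace 𝓘(ℝ, E) z) {y : E} (hy : y ∈ (extChartAt 𝓘(ℝ, E) x).target) :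
    chartRep (contract V η) x y = contrL (vfRep V x) (chartRep η x) y := by
  ext m
  rw [contrL_apply, chartRep_apply, chartRep_apply, contract_apply]
  congr 1
  ext i
  refine Fin.cases ?_ (fun j => ?_) i
  · simp only [vfRep, Matrix.cons_val_zero, ContinuousLinearEquiv.symm_apply_apply]
    rw [mpullbackWithin_apply, (isInvertible_mfderivWithin_extChartAt_symm hy).self_apply_inverse]
  · rfl

lemma chart_target_mem (x : M) :
    (extChartAt 𝓘(ℝ, E) x).target ∈ 𝓝 (extChartAt 𝓘(ℝ, E) x x) :=
  extChartAt_target_mem_nhds x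

lemma chartRep_contract_eventuallyEq {k : ℕ} (η : RawForm E M (k + 1)) (x : M)
    (V : ∀ z : M, TangentSpace 𝓘(ℝ, E) z) :
    chartRep (contract V η) x =ᶠ[𝓝 (extChartAt 𝓘(ℝ, E) x x)]
      contrL (vfRep V x) (chartRep η x) := by
  filter_upwards [chart_target_mem x] with y hy using chartRep_contract η x V hy

lemma contrL_congr {k : ℕ} {η θ : E → E [⋀^Fin (k + 1)]→L[ℝ] ℝ} {y : E} (V : E → E)
    (h : η =ᶠ[𝓝 y] θ) : contrL V η =ᶠ[𝓝 y] contrL V θ := by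
  filter_upwards [h] with z hz
  simp only [contrL, hz]

lemma contDiffAt_vfRep [CompleteSpace E] (V : SmoothVF E M) (x : M) :
    ContDiffAt ℝ ∞ (vfRep V x) (extChartAt 𝓘(ℝ, E) x x) := by
  have h := contMDiffWithinAt_mpullbackWithin_extChartAt_symm (m := ∞) (n := ∞) (s := univ)
    (V.contMDiff x) uniqueMDiffOn_univ (mem_univ x) le_rfl
  have h2 := contMDiffWithinAt_vectorSpace_iff_contDiffWithinAt.1 h
  refine h2.contDiffAt ?_
  simpa using chart_target_mem x

lemma isSmoothForm_contract [CompleteSpace E] {k : ℕ} {η : RawForm E M (k + 1)}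
    (hη : IsSmoothForm η) (V : SmoothVF E M) : IsSmoothForm (contract V η) := fun x =>
  (contDiffAt_contrL (hη x) (contDiffAt_vfRep V x)).congr_of_eventuallyEq
    (chartRep_contract_eventuallyEq η x V)

lemma vfRep_mlieBracket [CompleteSpace E] (V W : SmoothVF E M) (x : M) :
    mlieBracket 𝓘(ℝ, E) V W x =
      lieBracket ℝ (vfRep V x) (vfRep W x) (extChartAt 𝓘(ℝ, E) x x) := by
  have h2 : ∀ w : TangentSpace 𝓘(ℝ, E) x,
      mfderiv 𝓘(ℝ, E) 𝓘(ℝ, E) (extChartAt 𝓘(ℝ, E) x) x w = w := fun w => by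
    rw [mfderiv_extChartAt_self]; rfl
  have hb : mlieBracket 𝓘(ℝ, E) V W x =
      (mfderiv 𝓘(ℝ, E) 𝓘(ℝ, E) (extChartAt 𝓘(ℝ, E) x) x).inverse
        (id (lieBracketWithin ℝ (vfRep V x) (vfRep W x) (univ ∩ range 𝓘(ℝ, E))
          (extChartAt 𝓘(ℝ, E) x x) : E)) := rfl
  rw [hb, univ_inter, 𝓘(ℝ, E).range_eq_univ, lieBracketWithin_univ]
  exact (h2 _).symm.trans
    ((isInvertible_mfderiv_extChartAt (I := 𝓘(ℝ, E)) (mem_extChartAt_source x)).self_apply_inverse _)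

lemma contMDiffAt_fun_iff {f : M → ℝ} {x : M} : ContMDiffAt 𝓘(ℝ, E) 𝓘(ℝ, ℝ) ∞ f x ↔
      ContDiffAt ℝ ∞ (f ∘ (extChartAt 𝓘(ℝ, E) x).symm) (extChartAt 𝓘(ℝ, E) x x) := by
  rw [contMDiffAt_iff_source, 𝓘(ℝ, E).range_eq_univ, contMDiffWithinAt_univ,
    contMDiffAt_iff_contDiffAt]

lemma form_congr {k : ℕ} (η : RawForm E M k) {p q : M} (h : p = q) (m : Fin k → E) :
    η p m = η q m := by
  subst h; rfl

lemma contMDiffAt_symm (x : M) {y : E} (hy : y ∈ (extChartAt 𝓘(ℝ, E) x).target) :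
    ContMDiffAt 𝓘(ℝ, E) 𝓘(ℝ, E) ∞ (extChartAt 𝓘(ℝ, E) x).symm y :=
  (contMDiffOn_extChartAt_symm x).contMDiffAt
    ((isOpen_extChartAt_target x).mem_nhds hy)

/-- The exterior derivative does not depend on the chart used to compute it. -/
lemma chartRep_extDer {k : ℕ} {η : RawForm E M k} (hη : IsSmoothForm η) (x : M) {y : E}
    (hy : y ∈ (extChartAt 𝓘(ℝ, E) x).target) :
    chartRep (extDer η) x y = extDeriv (chartRep η x) y := by
  set φ := extChartAt 𝓘(ℝ, E) x
  set z := φ.symm y with hz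
  set ψ := extChartAt 𝓘(ℝ, E) z
  have hτ : ∀ y' ∈ φ.target, φ.symm y' ∈ ψ.source → ContMDiffAt 𝓘(ℝ, E) 𝓘(ℝ, E) ∞ (ψ ∘ φ.symm) y' :=
    fun y' h1 h2 => ContMDiffAt.comp y' (contMDiffAt_extChartAt' (by simpa [ψ] using h2))
      (contMDiffAt_symm x h1)
  have hzs : z ∈ ψ.source := mem_extChartAt_source z
  have hnear : ∀ᶠ y' in 𝓝 y, y' ∈ φ.target ∧ φ.symm y' ∈ ψ.source := by
    refine ((isOpen_extChartAt_target x).eventually_mem hy).and ?_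
    exact (contMDiffAt_symm x hy).continuousAt.eventually_mem
      ((isOpen_extChartAt_source z).mem_nhds hzs)
  have hpull : chartRep η x =ᶠ[𝓝 y] fun y' =>
      (chartRep η z ((ψ ∘ φ.symm) y')).compContinuousLinearMap (fderiv ℝ (ψ ∘ φ.symm) y') := by
    have hn2 := eventually_eventually_nhds.2 hnear
    filter_upwards [hn2] with y' hy'
    obtain ⟨h1, h2⟩ := hy'.self_of_nhds
    have hs : φ.symm =ᶠ[𝓝 y'] ψ.symm ∘ (ψ ∘ φ.symm) := by
      filter_upwards [hy'] with w hw
      exact (ψ.left_inv hw.2).symm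
    have hψ : (ψ ∘ φ.symm) y' ∈ ψ.target := ψ.map_source h2
    ext m
    have hm : ∀ v : E, (mfderiv 𝓘(ℝ, E) 𝓘(ℝ, E) φ.symm y' v : E) =
        mfderiv 𝓘(ℝ, E) 𝓘(ℝ, E) ψ.symm ((ψ ∘ φ.symm) y') (fderiv ℝ (ψ ∘ φ.symm) y' v) := by
      intro v
      rw [hs.mfderiv_eq, mfderiv_comp y'
        ((contMDiffAt_symm z hψ).mdifferentiableAt (by simp))
        ((hτ y' h1 h2).mdifferentiableAt (by simp)), mfderiv_eq_fderiv]
      rfl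
    have he : φ.symm y' = ψ.symm ((ψ ∘ φ.symm) y') := (ψ.left_inv h2).symm
    exact (form_congr η he _).trans (congrArg (η (ψ.symm ((ψ ∘ φ.symm) y')))
      (funext fun i => hm (m i)))
  have hτy : ContDiffAt ℝ ∞ (ψ ∘ φ.symm) y := (hτ y hy hzs).contDiffAt
  have hd : DifferentiableAt ℝ (chartRep η z) ((ψ ∘ φ.symm) y) :=
    (hη z).differentiableAt (by simp)
  rw [hpull.extDeriv_eq, extDeriv_pullback (f := ψ ∘ φ.symm) hd hτy
    (by rw [minSmoothness_of_isRCLikeNormedField]; exact WithTop.coe_le_coe.2 (le_top : (2 : ℕ∞) ≤ ⊤))]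
  ext m
  have hm : ∀ v : E, (mfderiv 𝓘(ℝ, E) 𝓘(ℝ, E) φ.symm y v : E) = fderiv ℝ (ψ ∘ φ.symm) y v := by
    intro v
    have hc : mfderiv 𝓘(ℝ, E) 𝓘(ℝ, E) (ψ ∘ φ.symm) y =
        (mfderiv 𝓘(ℝ, E) 𝓘(ℝ, E) ψ (φ.symm y)).comp (mfderiv 𝓘(ℝ, E) 𝓘(ℝ, E) φ.symm y) :=
      mfderiv_comp y ((contMDiffAt_extChartAt (x := z) (n := ∞)).mdifferentiableAt (by simp))
        ((contMDiffAt_symm x hy).mdifferentiableAt (by simp))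
    rw [← mfderiv_eq_fderiv, hc]
    have hi : mfderiv 𝓘(ℝ, E) 𝓘(ℝ, E) ψ (φ.symm y) = ContinuousLinearMap.id ℝ E :=
      mfderiv_extChartAt_self
    rw [hi]
    rfl
  exact (extDer_apply η z _).trans (congrArg (extDeriv (chartRep η z) (ψ z))
    (funext fun i => hm (m i)))

end Forms

section Fields
set_option linter.unusedSectionVars false
set_option linter.style.haveILetI false
open VectorField
variable {E : Type*} [NormedAddCommGroup E] [NormedSpace ℝ E] [CompleteSpace E]
  {M : Type*} [TopologicalSpace M] [ChartedSpace E M] [IsManifold 𝓘(ℝ, E) ∞ M]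

lemma SmoothVF.mdiff (V : SmoothVF E M) (x : M) :
    MDifferentiableAt 𝓘(ℝ, E) (𝓘(ℝ, E).prod 𝓘(ℝ, E))
      (fun x => (V x : TangentBundle 𝓘(ℝ, E) M)) x :=
  (V.contMDiff x).mdifferentiableAt (by simp)

/-- The Lie bracket of vector fields. -/
instance : Bracket (SmoothVF E M) (SmoothVF E M) where
  bracket V W := ⟨mlieBracket 𝓘(ℝ, E) V W, fun x => by
    haveI : IsManifold 𝓘(ℝ, E) (minSmoothness ℝ 2) M := by
      rw [minSmoothness_of_isRCLikeNormedField]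
      exact .of_le (n := ∞) (WithTop.coe_le_coe.2 (le_top : (2 : ℕ∞) ≤ ⊤))
    haveI : IsManifold 𝓘(ℝ, E) ((⊤ : ℕ∞) + 1) M := inferInstanceAs (IsManifold 𝓘(ℝ, E) ∞ M)
    exact ContMDiffAt.mlieBracket_vectorField (n := ⊤) (m := ⊤) (V.contMDiff x) (W.contMDiff x)
      (by simp)⟩

lemma SmoothVF.lie_apply (V W : SmoothVF E M) (x : M) :
    (⁅V, W⁆ : SmoothVF E M) x = mlieBracket 𝓘(ℝ, E) V W x := rfl

instance : LieRing (SmoothVF E M) where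
  add_lie U V W := by
    haveI : IsManifold 𝓘(ℝ, E) (minSmoothness ℝ 2) M := by
      rw [minSmoothness_of_isRCLikeNormedField]
      exact .of_le (n := ∞) (WithTop.coe_le_coe.2 (le_top : (2 : ℕ∞) ≤ ⊤))
    ext x
    exact mlieBracket_add_left (SmoothVF.mdiff U x) (SmoothVF.mdiff V x)
  lie_add U V W := by
    ext x
    exact mlieBracket_add_right (SmoothVF.mdiff V x) (SmoothVF.mdiff W x)
  lie_self V := by
    ext x
    rw [SmoothVF.lie_apply, mlieBracket_self]
    rfl
  leibniz_lie U V W := by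
    haveI : IsManifold 𝓘(ℝ, E) (minSmoothness ℝ 3) M := by
      rw [minSmoothness_of_isRCLikeNormedField]; infer_instance
    have h : minSmoothness ℝ 2 ≤ (∞ : WithTop ℕ∞) := by
      rw [minSmoothness_of_isRCLikeNormedField]
      exact WithTop.coe_le_coe.2 (le_top : (2 : ℕ∞) ≤ ⊤)
    ext x
    exact leibniz_identity_mlieBracket_apply ((U.contMDiff x).of_le h)
      ((V.contMDiff x).of_le h) ((W.contMDiff x).of_le h)

instance : LieAlgebra ℝ (SmoothVF E M) where
  lie_smul c V W := by
    ext x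
    exact mlieBracket_const_smul_right (SmoothVF.mdiff W x)
end Fields

section Calc
set_option linter.unusedSectionVars false
open VectorField
variable {E : Type*} [NormedAddCommGroup E] [NormedSpace ℝ E] [CompleteSpace E]
  {M : Type*} [TopologicalSpace M] [ChartedSpace E M] [IsManifold 𝓘(ℝ, E) ∞ M]

lemma smooth_two : minSmoothness ℝ 2 ≤ (∞ : WithTop ℕ∞) := by
  rw [minSmoothness_of_isRCLikeNormedField]
  exact WithTop.coe_le_coe.2 (le_top : (2 : ℕ∞) ≤ ⊤)

lemma chartRep_dFun (f : SmoothFun E M) (x : M) {y : E}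
    (hy : y ∈ (extChartAt 𝓘(ℝ, E) x).target) :
    chartRep (dFun (E := E) f) x y =
      extDeriv (fun z => .constOfIsEmpty ℝ E (Fin 0) ((f ∘ (extChartAt 𝓘(ℝ, E) x).symm) z)) y := by
  rw [extDeriv_constOfIsEmpty, ← mfderiv_eq_fderiv]
  have hc : mfderiv 𝓘(ℝ, E) 𝓘(ℝ, ℝ) (f ∘ (extChartAt 𝓘(ℝ, E) x).symm) y =
      (mfderiv 𝓘(ℝ, E) 𝓘(ℝ, ℝ) f ((extChartAt 𝓘(ℝ, E) x).symm y)).comp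
        (mfderiv 𝓘(ℝ, E) 𝓘(ℝ, E) (extChartAt 𝓘(ℝ, E) x).symm y) :=
    mfderiv_comp y ((f.contMDiff _).mdifferentiableAt (by simp))
      ((contMDiffAt_symm x hy).mdifferentiableAt (by simp))
  rw [hc]
  rfl

lemma chartRep_dFun_eventuallyEq (f : SmoothFun E M) (x : M) :
    chartRep (dFun (E := E) f) x =ᶠ[𝓝 (extChartAt 𝓘(ℝ, E) x x)]
      extDeriv (fun z => .constOfIsEmpty ℝ E (Fin 0)
        ((f ∘ (extChartAt 𝓘(ℝ, E) x).symm) z)) := by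
  filter_upwards [chart_target_mem x] with y hy using chartRep_dFun f x hy

lemma contDiffAt_zeroForm (f : SmoothFun E M) (x : M) :
    ContDiffAt ℝ ∞ (fun z => ContinuousAlternatingMap.constOfIsEmpty ℝ E (Fin 0)
      ((f ∘ (extChartAt 𝓘(ℝ, E) x).symm) z)) (extChartAt 𝓘(ℝ, E) x x) :=
  (ContinuousAlternatingMap.constOfIsEmptyLIE ℝ E ℝ (Fin 0)).contDiff.contDiffAt.comp _
    (contMDiffAt_fun_iff.1 (f.contMDiff x))

lemma isSmoothForm_dFun (f : SmoothFun E M) : IsSmoothForm (dFun (E := E) f) := fun x => by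
  refine ContDiffAt.congr_of_eventuallyEq ?_ (chartRep_dFun_eventuallyEq f x)
  exact (ContinuousAlternatingMap.alternatizeUncurryFinCLM ℝ E ℝ).contDiff.contDiffAt.comp _
    ((contDiffAt_zeroForm f x).fderiv_right (m := ∞) (by simp))

lemma extDer_dFun (f : SmoothFun E M) : extDer (dFun (E := E) f) = 0 := by
  funext x
  refine (extDer_eq_zero_iff _ x).2 ?_
  rw [(chartRep_dFun_eventuallyEq f x).extDeriv_eq]
  exact extDeriv_extDeriv_apply (contDiffAt_zeroForm f x) smooth_two

lemma dFun_eq_fderiv (f : SmoothFun E M) (x : M) (m : Fin 1 → TangentSpace 𝓘(ℝ, E) x) :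
    dFun (E := E) f x m =
      fderiv ℝ (f ∘ (extChartAt 𝓘(ℝ, E) x).symm) (extChartAt 𝓘(ℝ, E) x x) (m 0) := by
  refine (chartRep_self (dFun (E := E) f) x m).symm.trans ?_
  rw [chartRep_dFun f x (mem_extChartAt_target x), extDeriv_constOfIsEmpty]
  rfl

lemma dFun_add (f g : SmoothFun E M) :
    dFun (E := E) (f + g : SmoothFun E M) = dFun (E := E) f + dFun (E := E) g := by
  funext x
  ext m
  have h := mvfderiv_add (I := 𝓘(ℝ, E)) ((f.contMDiff x).mdifferentiableAt (by simp))
    ((g.contMDiff x).mdifferentiableAt (by simp))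
  exact congrArg (fun L => L (m 0)) h

lemma dFun_smul (c : ℝ) (f : SmoothFun E M) :
    dFun (E := E) (c • f : SmoothFun E M) = c • dFun (E := E) f := by
  funext x
  ext m
  have h : fderiv ℝ (⇑(c • f) ∘ (extChartAt 𝓘(ℝ, E) x).symm) (extChartAt 𝓘(ℝ, E) x x) =
      c • fderiv ℝ (f ∘ (extChartAt 𝓘(ℝ, E) x).symm) (extChartAt 𝓘(ℝ, E) x x) :=
    congrFun (fderiv_const_smul_field (𝕜 := ℝ) (f := f ∘ (extChartAt 𝓘(ℝ, E) x).symm) c) _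
  rw [dFun_eq_fderiv, h]
  exact congrArg (c • ·) (dFun_eq_fderiv f x m).symm

lemma IsSmoothForm.add {k : ℕ} {η θ : RawForm E M k} (hη : IsSmoothForm η)
    (hθ : IsSmoothForm θ) : IsSmoothForm (η + θ) := fun x => (hη x).add (hθ x)

lemma IsSmoothForm.smul {k : ℕ} {η : RawForm E M k} (hη : IsSmoothForm η) (c : ℝ) :
    IsSmoothForm (c • η) := fun x => (hη x).const_smul c

lemma isSmoothForm_zero {k : ℕ} : IsSmoothForm (0 : RawForm E M k) := fun x => by
  have : chartRep (0 : RawForm E M k) x = fun _ => 0 := rfl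
  rw [this]
  exact contDiffAt_const

lemma extDer_add {k : ℕ} {η θ : RawForm E M k} (hη : IsSmoothForm η) (hθ : IsSmoothForm θ) :
    extDer (η + θ) = extDer η + extDer θ := by
  funext x
  have h := extDeriv_add ((hη x).differentiableAt (by simp))
    ((hθ x).differentiableAt (by simp))
  unfold extDer
  rw [chartRep_add, h]
  rfl

lemma extDer_smul {k : ℕ} (c : ℝ) (η : RawForm E M k) : extDer (c • η) = c • extDer η := by
  funext x
  unfold extDer
  rw [chartRep_smul, extDeriv_smul]
  rfl

lemma extDer_zero {k : ℕ} : extDer (0 : RawForm E M k) = 0 := by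
  simpa using extDer_smul 0 (0 : RawForm E M k)

/-- The smooth function obtained by evaluating a smooth 3-form on three vector fields. -/
def evalThree {η : RawForm E M 3} (hη : IsSmoothForm η) :
    SmoothVF E M [⋀^Fin 3]→ₗ[ℝ] SmoothFun E M where
  toFun v := ⟨fun x => η x (fun i => v i x), fun x => by
    refine contMDiffAt_fun_iff.2 ?_
    have hs : ContDiffAt ℝ ∞ (fun y => chartRep η x y (fun i => vfRep (v i) x y))
        (extChartAt 𝓘(ℝ, E) x x) := by
      have h3 := contDiffAt_contrL (contDiffAt_contrL (contDiffAt_contrL (hη x)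
        (contDiffAt_vfRep (v 0) x)) (contDiffAt_vfRep (v 1) x)) (contDiffAt_vfRep (v 2) x)
      have h4 := (ContinuousAlternatingMap.constOfIsEmptyLIE ℝ E ℝ
        (Fin 0)).symm.contDiff.contDiffAt.comp _ h3
      refine h4.congr_of_eventuallyEq (.of_forall fun y => ?_)
      refine congrArg (chartRep η x y) ?_
      ext i
      fin_cases i <;> rfl
    refine hs.congr_of_eventuallyEq ?_
    filter_upwards [chart_target_mem x] with y hy
    exact (chartRep_vfRep η x hy (fun i z => v i z)).symm⟩
  map_update_add' v i a b := by
    ext x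
    have h' : ∀ c : SmoothVF E M, (fun j => (@Function.update _ _ (_) v i c) j x) =
        Function.update (fun j => v j x) i (c x) := fun c => by
      ext j
      exact Function.apply_update (fun _ (V : SmoothVF E M) => V x) v i c j
    change η x _ = η x _ + η x _
    rw [h', h', h']
    exact (η x).map_update_add _ _ _ _
  map_update_smul' v i c a := by
    ext x
    have h' : ∀ c : SmoothVF E M, (fun j => (@Function.update _ _ (_) v i c) j x) =
        Function.update (fun j => v j x) i (c x) := fun c => by
      ext j
      exact Function.apply_update (fun _ (V : SmoothVF E M) => V x) v i c j
    change η x _ = c • η x _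
    rw [h', h']
    exact (η x).map_update_smul _ _ _ _
  map_eq_zero_of_eq' v i j h hij := by
    ext x
    exact (η x).map_eq_zero_of_eq _ (congrArg (fun V : SmoothVF E M => V x) h) hij

lemma evalThree_apply {η : RawForm E M 3} (hη : IsSmoothForm η) (v : Fin 3 → SmoothVF E M)
    (x : M) : evalThree hη v x = η x (fun i => v i x) := rfl
end Calc

section Algebra

/-- A Lie 2-algebra, i.e. an `L_∞`-algebra concentrated in degrees `0` and `-1`, on the graded
vector space `V₁[1] ⊕ V₀`: the unary bracket `δ`, the binary brackets `V₀ × V₀ → V₀` and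
`V₀ × V₁ → V₁` (with `[h, x] = -[x, h]`), and the ternary bracket, satisfying the higher Jacobi
identities. -/
structure Lie2Algebra (V₀ V₁ : Type*) [AddCommGroup V₀] [Module ℝ V₀] [AddCommGroup V₁]
    [Module ℝ V₁] where
  δ : V₁ →ₗ[ℝ] V₀
  br : V₀ →ₗ[ℝ] V₀ →ₗ[ℝ] V₀
  act : V₀ →ₗ[ℝ] V₁ →ₗ[ℝ] V₁
  br₃ : V₀ [⋀^Fin 3]→ₗ[ℝ] V₁
  br_self : ∀ x, br x x = 0
  δ_act : ∀ x h, δ (act x h) = br x (δ h)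
  act_δ : ∀ h k, act (δ h) k = -act (δ k) h
  δ_br₃ : ∀ x y z, δ (br₃ ![x, y, z]) = br x (br y z) - br y (br x z) + br z (br x y)
  br₃_δ : ∀ x y h, br₃ ![x, y, δ h] = act x (act y h) - act y (act x h) - act (br x y) h
  coherence : ∀ x y z u,
    act x (br₃ ![y, z, u]) - act y (br₃ ![x, z, u]) + act z (br₃ ![x, y, u])
        - act u (br₃ ![x, y, z]) =
      br₃ ![br x y, z, u] - br₃ ![br x z, y, u] + br₃ ![br x u, y, z]
        + br₃ ![br y z, x, u] - br₃ ![br y u, x, z] + br₃ ![br z u, x, y]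

/-- An `L_∞`-morphism `(f₁, f₂)` between Lie 2-algebras; `f₁` has a component in each degree. -/
@[ext]
structure LInftyHom {V₀ V₁ W₀ W₁ : Type*} [AddCommGroup V₀] [Module ℝ V₀] [AddCommGroup V₁]
    [Module ℝ V₁] [AddCommGroup W₀] [Module ℝ W₀] [AddCommGroup W₁] [Module ℝ W₁]
    (A : Lie2Algebra V₀ V₁) (B : Lie2Algebra W₀ W₁) where
  f₁ : V₀ →ₗ[ℝ] W₀
  f₁' : V₁ →ₗ[ℝ] W₁
  f₂ : V₀ →ₗ[ℝ] V₀ →ₗ[ℝ] W₁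
  f₂_self : ∀ x, f₂ x x = 0
  map_δ : ∀ h, B.δ (f₁' h) = f₁ (A.δ h)
  map_br : ∀ x y, B.δ (f₂ x y) = f₁ (A.br x y) - B.br (f₁ x) (f₁ y)
  map_act : ∀ x h, f₂ x (A.δ h) = f₁' (A.act x h) - B.act (f₁ x) (f₁' h)
  map_br₃ : ∀ x y z, f₁' (A.br₃ ![x, y, z]) - B.br₃ ![f₁ x, f₁ y, f₁ z] =
    f₂ x (A.br y z) - f₂ y (A.br x z) + f₂ z (A.br x y)
      + B.act (f₁ x) (f₂ y z) - B.act (f₁ y) (f₂ x z) + B.act (f₁ z) (f₂ x y)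

/-- The Chevalley–Eilenberg cocycle condition for a real 3-cochain (trivial coefficients). -/
def IsThreeCocycle {L : Type*} [LieRing L] [LieAlgebra ℝ L] (c : L [⋀^Fin 3]→ₗ[ℝ] ℝ) : Prop :=
  ∀ x y z u : L, -c ![⁅x, y⁆, z, u] + c ![⁅x, z⁆, y, u] - c ![⁅x, u⁆, y, z]
    - c ![⁅y, z⁆, x, u] + c ![⁅y, u⁆, x, z] - c ![⁅z, u⁆, x, y] = 0

/-- The Lie 2-algebra `ℝ[1] ⊕_c L`: the binary bracket is the Lie bracket of `L`, the ternary
bracket is the 3-cocycle `c`, and all other brackets vanish. -/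
def Lie2Algebra.ofThreeCocycle {L : Type*} [LieRing L] [LieAlgebra ℝ L] (c : L [⋀^Fin 3]→ₗ[ℝ] ℝ)
    (hc : IsThreeCocycle c) : Lie2Algebra L ℝ where
  δ := 0
  br := (LieModule.toEnd ℝ L L : L →ₗ[ℝ] L →ₗ[ℝ] L)
  act := 0
  br₃ := c
  br_self x := lie_self x
  δ_act x h := by simp
  act_δ h k := by simp
  δ_br₃ x y z := by
    have h := lie_jacobi x y z
    change 0 = ⁅x, ⁅y, z⁆⁆ - ⁅y, ⁅x, z⁆⁆ + ⁅z, ⁅x, y⁆⁆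
    rw [← h, ← lie_skew z x, lie_neg]
    abel
  br₃_δ x y h := by simpa using c.map_coord_zero 2 rfl
  coherence x y z u := by
    have h := hc x y z u
    simp only [LinearMap.zero_apply]
    change _ = c ![⁅x, y⁆, z, u] - c ![⁅x, z⁆, y, u] + c ![⁅x, u⁆, y, z]
      + c ![⁅y, z⁆, x, u] - c ![⁅y, u⁆, x, z] + c ![⁅z, u⁆, x, y]
    linarith
end Algebra

section Geometry
set_option linter.unusedSectionVars false
open VectorField LieModule.Cohomology
variable {E : Type*} [NormedAddCommGroup E] [NormedSpace ℝ E] [CompleteSpace E]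
  {M : Type*} [TopologicalSpace M] [ChartedSpace E M] [IsManifold 𝓘(ℝ, E) ∞ M]

lemma extDer_extDer {k : ℕ} {η : RawForm E M k} (hη : IsSmoothForm η) :
    extDer (extDer η) = 0 := by
  funext x
  refine (extDer_eq_zero_iff _ x).2 ?_
  have h : chartRep (extDer η) x =ᶠ[𝓝 (extChartAt 𝓘(ℝ, E) x x)] extDeriv (chartRep η x) := by
    filter_upwards [chart_target_mem x] with y hy using chartRep_extDer hη x hy
  rw [h.extDeriv_eq]
  exact extDeriv_extDeriv_apply (hη x) smooth_two

lemma extDer_neg {k : ℕ} (η : RawForm E M k) : extDer (-η) = -extDer η := by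
  have e : ∀ {j : ℕ} (θ : RawForm E M j), -θ = (-1 : ℝ) • θ := fun θ => (neg_one_smul ℝ θ).symm
  rw [e, e, extDer_smul]

lemma contract_add_left {k : ℕ} (V W : SmoothVF E M) (η : RawForm E M (k + 1)) :
    contract (V + W : SmoothVF E M) η = contract V η + contract W η := by
  funext x
  ext m
  exact congrArg (fun f => f m) ((η x).toAlternatingMap.curryLeft.map_add (V x) (W x))

lemma contract_smul_left {k : ℕ} (c : ℝ) (V : SmoothVF E M) (η : RawForm E M (k + 1)) :
    contract (c • V : SmoothVF E M) η = c • contract V η := by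
  funext x
  ext m
  exact congrArg (fun f => f m) ((η x).toAlternatingMap.curryLeft.map_smul c (V x))

lemma contract_zero_left {k : ℕ} (η : RawForm E M (k + 1)) :
    contract (0 : SmoothVF E M) η = 0 := by
  simpa using contract_smul_left 0 (0 : SmoothVF E M) η

lemma contract_add_right {k : ℕ} (V : SmoothVF E M) (η θ : RawForm E M (k + 1)) :
    contract V (η + θ) = contract V η + contract V θ := rfl

lemma contract_smul_right {k : ℕ} (c : ℝ) (V : SmoothVF E M) (η : RawForm E M (k + 1)) :
    contract V (c • η) = c • contract V η := rfl

variable (E M) in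
/-- A 2-plectic form: a closed smooth 3-form `form` such that `v ↦ ι_v form` is injective on each
tangent space. -/
structure TwoPlectic where
  form : RawForm E M 3
  smooth : IsSmoothForm form
  closed : extDer form = 0
  nondegenerate : ∀ x, Function.Injective (form x).toAlternatingMap.curryLeft

namespace TwoPlectic
variable (P : TwoPlectic E M)

/-- `V` is the Hamiltonian vector field of the 1-form `α`, i.e. `dα = -ι_V ω`. -/
def Generates (α : RawForm E M 1) (V : SmoothVF E M) : Prop :=
  extDer α = -contract V P.form

variable {P} in
lemma Generates.add {α β : RawForm E M 1} (hα : IsSmoothForm α) (hβ : IsSmoothForm β)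
    {V W : SmoothVF E M} (hV : P.Generates α V) (hW : P.Generates β W) :
    P.Generates (α + β) (V + W : SmoothVF E M) := by
  unfold Generates at hV hW ⊢
  rw [extDer_add hα hβ, hV, hW, contract_add_left, neg_add]

variable {P} in
lemma Generates.smul {α : RawForm E M 1} (c : ℝ) {V : SmoothVF E M} (hV : P.Generates α V) :
    P.Generates (c • α) (c • V : SmoothVF E M) := by
  unfold Generates at hV ⊢
  rw [extDer_smul, hV, contract_smul_left, smul_neg]

/-- Hamiltonian vector fields: those generated by a smooth 1-form. -/
def IsHamVF (V : SmoothVF E M) : Prop := ∃ α : RawForm E M 1, IsSmoothForm α ∧ P.Generates α V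

/-- The space of Hamiltonian 1-forms. -/
def Ham : Submodule ℝ (RawForm E M 1) where
  carrier := {α | IsSmoothForm α ∧ ∃ V : SmoothVF E M, P.Generates α V}
  add_mem' := by
    rintro α β ⟨hα, V, hV⟩ ⟨hβ, W, hW⟩
    exact ⟨hα.add hβ, V + W, hV.add hα hβ hW⟩
  zero_mem' := by
    refine ⟨isSmoothForm_zero, 0, ?_⟩
    unfold Generates
    rw [extDer_zero, contract_zero_left, neg_zero]
  smul_mem' := by
    rintro c α ⟨hα, V, hV⟩
    exact ⟨hα.smul c, c • V, hV.smul c⟩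

variable {P}

lemma contract_injective {V W : SmoothVF E M} (h : contract V P.form = contract W P.form) :
    V = W := by
  ext x
  refine P.nondegenerate x ?_
  ext m
  exact congrArg (fun η : RawForm E M 2 => η x m) h

lemma Generates.unique {α : RawForm E M 1} {V W : SmoothVF E M} (hV : P.Generates α V)
    (hW : P.Generates α W) : V = W :=
  contract_injective (P := P) (neg_injective (hV.symm.trans hW))

lemma IsHamVF.extDer_contract {V : SmoothVF E M} (hV : P.IsHamVF V) :
    extDer (contract V P.form) = 0 := by
  obtain ⟨α, hα, h⟩ := hV
  have h2 := extDer_extDer hα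
  rw [h, extDer_neg] at h2
  exact neg_eq_zero.1 h2

lemma local_closed (P : TwoPlectic E M) (x : M) :
    extDeriv (chartRep P.form x) (extChartAt 𝓘(ℝ, E) x x) = 0 :=
  (extDer_eq_zero_iff _ x).1 (congrFun P.closed x)

lemma IsHamVF.local_closed {V : SmoothVF E M} (hV : P.IsHamVF V) (x : M) :
    extDeriv (contrL (vfRep V x) (chartRep P.form x)) (extChartAt 𝓘(ℝ, E) x x) = 0 := by
  rw [← (chartRep_contract_eventuallyEq P.form x V).extDeriv_eq]
  exact (extDer_eq_zero_iff _ x).1 (congrFun hV.extDer_contract x)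

/-- The exterior derivative of `ι_W ι_V ω` is `-ι_[V, W] ω` for Hamiltonian `V`, `W`. -/
lemma extDer_contract_contract {V W : SmoothVF E M} (hV : P.IsHamVF V) (hW : P.IsHamVF W) :
    extDer (contract W (contract V P.form)) = -contract (⁅V, W⁆ : SmoothVF E M) P.form := by
  funext x
  ext m
  refine (extDer_apply _ x m).trans ?_
  have h : chartRep (contract W (contract V P.form)) x =ᶠ[𝓝 (extChartAt 𝓘(ℝ, E) x x)]
      contrL (vfRep W x) (contrL (vfRep V x) (chartRep P.form x)) :=
    (chartRep_contract_eventuallyEq (contract V P.form) x W).trans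
      (contrL_congr _ (chartRep_contract_eventuallyEq P.form x V))
  rw [h.extDeriv_eq, local_bracket (P.smooth x) (contDiffAt_vfRep V x) (contDiffAt_vfRep W x)
    (P.local_closed x) (hV.local_closed x) (hW.local_closed x)]
  have h2 : ∀ m : Fin 2 → E, contrL (lieBracket ℝ (vfRep V x) (vfRep W x)) (chartRep P.form x)
      (extChartAt 𝓘(ℝ, E) x x) m =
        P.form x (Matrix.vecCons (mlieBracket 𝓘(ℝ, E) V W x : TangentSpace 𝓘(ℝ, E) x) m) := by
    intro m
    rw [contrL_apply, ← vfRep_mlieBracket V W x]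
    exact chartRep_self P.form x _
  exact congrArg Neg.neg (h2 m)

lemma isSmoothForm_contract_contract (P : TwoPlectic E M) (V W : SmoothVF E M) :
    IsSmoothForm (contract W (contract V P.form)) :=
  isSmoothForm_contract (isSmoothForm_contract P.smooth V) W

variable (P)

/-- The Hamiltonian vector field of a Hamiltonian 1-form. -/
def hamVF : P.Ham →ₗ[ℝ] SmoothVF E M where
  toFun α := α.2.2.choose
  map_add' α β := ((α + β).2.2.choose_spec : P.Generates _ _).unique
    (Generates.add α.2.1 β.2.1 α.2.2.choose_spec β.2.2.choose_spec)
  map_smul' c α := ((c • α).2.2.choose_spec : P.Generates _ _).unique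
    (Generates.smul c α.2.2.choose_spec)

lemma hamVF_spec (α : P.Ham) : P.Generates α (P.hamVF α) := α.2.2.choose_spec

lemma isHamVF_hamVF (α : P.Ham) : P.IsHamVF (P.hamVF α) := ⟨α, α.2.1, P.hamVF_spec α⟩

lemma hamVF_eq {α : P.Ham} {V : SmoothVF E M} (h : P.Generates α V) : P.hamVF α = V :=
  (P.hamVF_spec α).unique h

/-- The differential from functions to Hamiltonian 1-forms. -/
def dHam : SmoothFun E M →ₗ[ℝ] P.Ham where
  toFun f := ⟨dFun f, isSmoothForm_dFun f, 0, by
    unfold Generates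
    rw [extDer_dFun, contract_zero_left, neg_zero]⟩
  map_add' f g := Subtype.ext (dFun_add f g)
  map_smul' c f := Subtype.ext (dFun_smul c f)

lemma hamVF_dHam (f : SmoothFun E M) : P.hamVF (P.dHam f) = 0 := by
  refine P.hamVF_eq ?_
  unfold Generates
  rw [contract_zero_left, neg_zero]
  exact extDer_dFun f

/-- The binary bracket `ω(v_α, v_β, ·)` of Hamiltonian 1-forms. -/
def hamBracket : P.Ham →ₗ[ℝ] P.Ham →ₗ[ℝ] P.Ham :=
  LinearMap.mk₂ ℝ (fun α β => ⟨contract (P.hamVF β) (contract (P.hamVF α) P.form),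
      P.isSmoothForm_contract_contract _ _, ⁅P.hamVF α, P.hamVF β⁆,
      extDer_contract_contract (P.isHamVF_hamVF α) (P.isHamVF_hamVF β)⟩)
    (fun α β γ => Subtype.ext (by
      change contract _ (contract _ _) = contract _ (contract _ _) + contract _ (contract _ _)
      rw [map_add, contract_add_left, contract_add_right]))
    (fun c α β => Subtype.ext (by
      change contract _ (contract _ _) = c • contract _ (contract _ _)
      rw [map_smul, contract_smul_left, contract_smul_right]))
    (fun α β γ => Subtype.ext (by
      change contract _ (contract _ _) = contract _ (contract _ _) + contract _ (contract _ _)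
      rw [map_add, contract_add_left]))
    (fun c α β => Subtype.ext (by
      change contract _ (contract _ _) = c • contract _ (contract _ _)
      rw [map_smul, contract_smul_left]))

lemma hamVF_hamBracket (α β : P.Ham) :
    P.hamVF (P.hamBracket α β) = ⁅P.hamVF α, P.hamVF β⁆ :=
  P.hamVF_eq (extDer_contract_contract (P.isHamVF_hamVF α) (P.isHamVF_hamVF β))

/-- The function `ω(U, V, W)`, trilinear and alternating in the vector fields. -/
def triple : SmoothVF E M [⋀^Fin 3]→ₗ[ℝ] SmoothFun E M := evalThree P.smooth

lemma triple_apply (U V W : SmoothVF E M) (x : M) :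
    P.triple ![U, V, W] x = P.form x ![U x, V x, W x] := by
  change P.form x _ = _
  congr 1
  ext i
  fin_cases i <;> rfl

lemma dFun_triple {U V W : SmoothVF E M} (hU : P.IsHamVF U) (hV : P.IsHamVF V)
    (hW : P.IsHamVF W) :
    dFun (E := E) (P.triple ![U, V, W]) = -(contract (⁅V, W⁆ : SmoothVF E M) (contract U P.form)
      + contract (⁅W, U⁆ : SmoothVF E M) (contract V P.form)
      + contract (⁅U, V⁆ : SmoothVF E M) (contract W P.form)) := by
  funext x
  ext m
  obtain ⟨a, rfl⟩ : ∃ a, m = ![a] := ⟨m 0, by ext i; fin_cases i; rfl⟩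
  rw [dFun_eq_fderiv]
  have h : (P.triple ![U, V, W] : M → ℝ) ∘ (extChartAt 𝓘(ℝ, E) x).symm
      =ᶠ[𝓝 (extChartAt 𝓘(ℝ, E) x x)]
      fun y => chartRep P.form x y ![vfRep U x y, vfRep V x y, vfRep W x y] := by
    filter_upwards [chart_target_mem x] with y hy
    have := chartRep_vfRep P.form x hy (fun i z => (![U, V, W] : Fin 3 → SmoothVF E M) i z)
    refine this.symm.trans (congrArg (chartRep P.form x y) ?_)
    ext i
    fin_cases i <;> rfl
  rw [h.fderiv_eq]
  refine (local_jac (P.smooth x) (contDiffAt_vfRep U x) (contDiffAt_vfRep V x)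
    (contDiffAt_vfRep W x) (P.local_closed x) (hU.local_closed x) (hV.local_closed x)
    (hW.local_closed x) a).trans ?_
  simp only [← vfRep_mlieBracket, vfRep_self]
  have e : ∀ m : Fin 3 → E, chartRep P.form x (extChartAt 𝓘(ℝ, E) x x) m = P.form x m :=
    fun m => chartRep_self P.form x m
  rw [e, e, e]
  rfl

lemma triple_coherence {U V W X : SmoothVF E M} (hU : P.IsHamVF U) (hV : P.IsHamVF V)
    (hW : P.IsHamVF W) (hX : P.IsHamVF X) :
    P.triple ![⁅U, V⁆, W, X] - P.triple ![⁅U, W⁆, V, X] + P.triple ![⁅U, X⁆, V, W]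
      + P.triple ![⁅V, W⁆, U, X] - P.triple ![⁅V, X⁆, U, W] + P.triple ![⁅W, X⁆, U, V] = 0 := by
  ext x
  have h := local_four (P.smooth x) (contDiffAt_vfRep U x) (contDiffAt_vfRep V x)
    (contDiffAt_vfRep W x) (contDiffAt_vfRep X x) (P.local_closed x) (hU.local_closed x)
    (hV.local_closed x) (hW.local_closed x) (hX.local_closed x)
  simp only [← vfRep_mlieBracket, vfRep_self] at h
  have e : ∀ m : Fin 3 → E, chartRep P.form x (extChartAt 𝓘(ℝ, E) x x) m = P.form x m :=
    fun m => chartRep_self P.form x m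
  rw [e, e, e, e, e, e] at h
  change P.triple ![⁅U, V⁆, W, X] x - P.triple ![⁅U, W⁆, V, X] x + P.triple ![⁅U, X⁆, V, W] x
      + P.triple ![⁅V, W⁆, U, X] x - P.triple ![⁅V, X⁆, U, W] x + P.triple ![⁅W, X⁆, U, V] x = 0
  simp only [triple_apply]
  exact h
end TwoPlectic
end Geometry

section MomentMaps
set_option linter.unusedSectionVars false
open LieModule.Cohomology
variable {E : Type*} [NormedAddCommGroup E] [NormedSpace ℝ E] [CompleteSpace E]
  {M : Type*} [TopologicalSpace M] [ChartedSpace E M] [IsManifold 𝓘(ℝ, E) ∞ M]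

namespace TwoPlectic
variable (P : TwoPlectic E M)

/-- The Lie 2-algebra `L_∞(M, ω)` of observables: `δ` is the de Rham differential, the binary
bracket is `ω(v_α, v_β, ·)`, the ternary bracket is `-ω(v_α, v_β, v_γ)`. -/
def observables : Lie2Algebra P.Ham (SmoothFun E M) where
  δ := P.dHam
  br := P.hamBracket
  act := 0
  br₃ := -(P.triple.compLinearMap P.hamVF)
  br_self α := by
    refine Subtype.ext ?_
    funext x
    ext m
    exact (P.form x).map_eq_zero_of_eq _ (i := 0) (j := 1) rfl (by decide)
  δ_act α h := by
    refine Subtype.ext ?_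
    change _ = contract (P.hamVF (P.dHam h)) (contract (P.hamVF α) P.form)
    rw [hamVF_dHam, contract_zero_left, LinearMap.zero_apply, LinearMap.zero_apply, map_zero]
    rfl
  act_δ h k := by simp
  δ_br₃ α β γ := by
    have e : (P.triple.compLinearMap P.hamVF) ![α, β, γ] =
        P.triple ![P.hamVF α, P.hamVF β, P.hamVF γ] := by
      rw [AlternatingMap.compLinearMap_apply]
      congr 1
      ext i : 1
      fin_cases i <;> rfl
    rw [AlternatingMap.neg_apply, map_neg, e]
    refine Subtype.ext ?_
    have h := P.dFun_triple (P.isHamVF_hamVF α) (P.isHamVF_hamVF β) (P.isHamVF_hamVF γ)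
    change -(dFun _) = contract (P.hamVF (P.hamBracket β γ)) (contract (P.hamVF α) P.form)
      - contract (P.hamVF (P.hamBracket α γ)) (contract (P.hamVF β) P.form)
      + contract (P.hamVF (P.hamBracket α β)) (contract (P.hamVF γ) P.form)
    have s : (⁅P.hamVF γ, P.hamVF α⁆ : SmoothVF E M) = (-1 : ℝ) • ⁅P.hamVF α, P.hamVF γ⁆ := by
      rw [neg_one_smul, lie_skew]
    rw [h, hamVF_hamBracket, hamVF_hamBracket, hamVF_hamBracket, neg_neg, s, contract_smul_left,
      neg_one_smul, ← sub_eq_add_neg]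
  br₃_δ α β h := by
    have e : (P.triple.compLinearMap P.hamVF) ![α, β, P.dHam h] = 0 := by
      rw [AlternatingMap.compLinearMap_apply]
      exact P.triple.map_coord_zero 2 (P.hamVF_dHam h)
    rw [AlternatingMap.neg_apply, e]
    simp
  coherence α β γ κ := by
    have e : ∀ a b c, (-(P.triple.compLinearMap P.hamVF)) ![a, b, c] =
        -P.triple ![P.hamVF a, P.hamVF b, P.hamVF c] := fun a b c => by
      rw [AlternatingMap.neg_apply, AlternatingMap.compLinearMap_apply]
      congr 2
      ext i : 1
      fin_cases i <;> rfl
    have h := P.triple_coherence (P.isHamVF_hamVF α) (P.isHamVF_hamVF β) (P.isHamVF_hamVF γ)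
      (P.isHamVF_hamVF κ)
    simp only [e, hamVF_hamBracket, LinearMap.zero_apply]
    rw [← neg_eq_zero] at h
    rw [sub_self, zero_add, sub_self, ← h]
    abel

/-- A homotopy moment map for a Lie 2-algebra `A` whose degree zero part acts on `M` through `ρ`:
an `L_∞`-morphism `F` to `L_∞(M, ω)` with `-ι_{ρ x} ω = d (F₁ x)`. -/
def IsMomentMap {V₀ V₁ : Type*} [AddCommGroup V₀] [Module ℝ V₀] [AddCommGroup V₁] [Module ℝ V₁]
    {A : Lie2Algebra V₀ V₁} (ρ : V₀ →ₗ[ℝ] SmoothVF E M) (F : LInftyHom A P.observables) : Prop :=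
  ∀ x, P.Generates (F.f₁ x) (ρ x)
end TwoPlectic

variable (E M) in
/-- The space of closed smooth 1-forms. -/
def ClosedForms : Submodule ℝ (RawForm E M 1) where
  carrier := {α | IsSmoothForm α ∧ extDer α = 0}
  add_mem' := by
    rintro α β ⟨hα, hα'⟩ ⟨hβ, hβ'⟩
    exact ⟨hα.add hβ, by rw [extDer_add hα hβ, hα', hβ', add_zero]⟩
  zero_mem' := ⟨isSmoothForm_zero, extDer_zero⟩
  smul_mem' := by
    rintro c α ⟨hα, hα'⟩
    exact ⟨hα.smul c, by rw [extDer_smul, hα', smul_zero]⟩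

variable (E M) in
/-- The differential from functions to closed 1-forms. -/
def dClosed : SmoothFun E M →ₗ[ℝ] ClosedForms E M where
  toFun f := ⟨dFun f, isSmoothForm_dFun f, extDer_dFun f⟩
  map_add' f g := Subtype.ext (dFun_add f g)
  map_smul' c f := Subtype.ext (dFun_smul c f)

variable (E M) in
/-- The first de Rham cohomology: closed 1-forms modulo exact ones. -/
def H1 : Type _ := ClosedForms E M ⧸ LinearMap.range (dClosed E M)

instance : AddCommGroup (H1 E M) :=
  inferInstanceAs (AddCommGroup (ClosedForms E M ⧸ LinearMap.range (dClosed E M)))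
instance : Module ℝ (H1 E M) :=
  inferInstanceAs (Module ℝ (ClosedForms E M ⧸ LinearMap.range (dClosed E M)))

/-- The cohomology class of a closed 1-form. -/
def H1.mk : ClosedForms E M →ₗ[ℝ] H1 E M := Submodule.mkQ _

/-- `H1` as an abelian Lie algebra. -/
instance : LieRing (H1 E M) where
  bracket _ _ := 0
  add_lie _ _ _ := (add_zero _).symm
  lie_add _ _ _ := (add_zero _).symm
  lie_self _ := rfl
  leibniz_lie _ _ _ := (add_zero _).symm

instance : LieAlgebra ℝ (H1 E M) where
  lie_smul _ _ _ := (smul_zero _).symm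

instance : IsLieAbelian (H1 E M) where
  trivial _ _ := rfl

/-- `H1` as a trivial representation of any Lie algebra. -/
instance {L : Type*} [LieRing L] : LieRingModule L (H1 E M) where
  bracket _ _ := 0
  add_lie _ _ _ := (add_zero _).symm
  lie_add _ _ _ := (add_zero _).symm
  leibniz_lie _ _ _ := (add_zero _).symm

instance {L : Type*} [LieRing L] [LieAlgebra ℝ L] : LieModule ℝ L (H1 E M) where
  smul_lie _ _ _ := (smul_zero _).symm
  lie_smul _ _ _ := (smul_zero _).symm

variable {𝔤 : Type*} [LieRing 𝔤] [LieAlgebra ℝ 𝔤]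

/-- A linear choice of Hamiltonian 1-forms `α_x` for the vector fields `v_x`. -/
structure HamLift (P : TwoPlectic E M) (v : 𝔤 →ₗ⁅ℝ⁆ SmoothVF E M) where
  toLin : 𝔤 →ₗ[ℝ] P.Ham
  generates : ∀ x, P.Generates (toLin x) (v x)

namespace HamLift
variable {P : TwoPlectic E M} {v : 𝔤 →ₗ⁅ℝ⁆ SmoothVF E M} (α : HamLift P v)

lemma isHamVF (α : HamLift P v) (x : 𝔤) : P.IsHamVF (v x) := ⟨α.toLin x, (α.toLin x).2.1, α.generates x⟩

/-- The closed 1-form `α_[x, y] - ι(v_x ∧ v_y) ω`. -/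
def defect : 𝔤 →ₗ[ℝ] 𝔤 →ₗ[ℝ] ClosedForms E M :=
  LinearMap.mk₂ ℝ (fun x y => ⟨(α.toLin ⁅x, y⁆ : RawForm E M 1)
      - contract (v y) (contract (v x) P.form), by
        rw [sub_eq_add_neg]
        exact (α.toLin ⁅x, y⁆).2.1.add
          (by simpa using (P.isSmoothForm_contract_contract (v x) (v y)).smul (-1)), by
        have h : extDer (α.toLin ⁅x, y⁆ : RawForm E M 1) =
            -contract (⁅v x, v y⁆ : SmoothVF E M) P.form := by
          rw [← LieHom.map_lie]; exact α.generates _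
        rw [sub_eq_add_neg, extDer_add (α.toLin ⁅x, y⁆).2.1
          (by simpa using (P.isSmoothForm_contract_contract (v x) (v y)).smul (-1)),
          extDer_neg, TwoPlectic.extDer_contract_contract (α.isHamVF x) (α.isHamVF y), h]
        abel⟩)
    (fun x x' y => Subtype.ext (by
      change _ - _ = (_ - _) + (_ - _)
      rw [add_lie, map_add, map_add, contract_add_left, contract_add_right, Submodule.coe_add]
      abel))
    (fun c x y => Subtype.ext (by
      change _ - _ = c • (_ - _)
      rw [smul_lie, map_smul, map_smul, contract_smul_left, contract_smul_right, smul_sub]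
      rfl))
    (fun x y y' => Subtype.ext (by
      change _ - _ = (_ - _) + (_ - _)
      rw [lie_add, map_add, map_add, contract_add_left, Submodule.coe_add]
      abel))
    (fun c x y => Subtype.ext (by
      change _ - _ = c • (_ - _)
      rw [lie_smul, map_smul, map_smul, contract_smul_left, smul_sub]
      rfl))

/-- The 2-cochain `B(x, y) = [α_[x, y] - ι(v_x ∧ v_y) ω]` with values in `H1`. -/
def B : twoCochain ℝ 𝔤 (H1 E M) :=
  ⟨α.defect.compr₂ H1.mk, fun x => by
    have : α.defect x x = 0 := Subtype.ext (by
      change (α.toLin ⁅x, x⁆ : RawForm E M 1) - contract (v x) (contract (v x) P.form) = 0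
      rw [lie_self, map_zero]
      funext z
      ext m
      have h : P.form z (Matrix.vecCons (v x z) (Matrix.vecCons (v x z) m)) = 0 :=
        (P.form z).map_eq_zero_of_eq _ (i := 0) (j := 1) rfl (by decide)
      change 0 - P.form z (Matrix.vecCons (v x z) (Matrix.vecCons (v x z) m)) = 0
      rw [h, sub_zero])
    rw [LinearMap.compr₂_apply, this, map_zero]⟩

/-- The 1-cochain `x ↦ [α_x - α'_x]`. -/
def diff (α' : HamLift P v) : oneCochain ℝ 𝔤 (H1 E M) :=
  H1.mk ∘ₗ LinearMap.codRestrict (ClosedForms E M) (P.Ham.subtype ∘ₗ (α.toLin - α'.toLin))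
    (fun x => ⟨((α.toLin - α'.toLin) x).2.1, by
      change extDer ((α.toLin x : RawForm E M 1) - (α'.toLin x : RawForm E M 1)) = 0
      rw [sub_eq_add_neg, extDer_add (α.toLin x).2.1
        (by simpa using (α'.toLin x).2.1.smul (-1)), extDer_neg, α.generates x, α'.generates x]
      abel⟩)

/-- The extension of `𝔤` by `H1` given by the cocycle `B`: the space `𝔤 ⊕ H1` with bracket
`[(x₁, A₁), (x₂, A₂)] = ([x₁, x₂], B(x₁, x₂))`. -/
def extension (hB : α.B ∈ twoCocycle ℝ 𝔤 (H1 E M)) : LieAlgebra.Extension ℝ (H1 E M) 𝔤 :=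
  LieAlgebra.Extension.ofTwoCocycle ⟨α.B, hB⟩

/-- The element `(x, A)` of `𝔤 ⊕ H1`. -/
def pair (hB : α.B ∈ twoCocycle ℝ 𝔤 (H1 E M)) (x : 𝔤) (A : H1 E M) : (α.extension hB).L :=
  (⟨(x, A)⟩ : LieAlgebra.ofTwoCocycle (⟨α.B, hB⟩ : twoCocycle ℝ 𝔤 (H1 E M)))
end HamLift

/-- The 3-cochain `ω_{3p}(x, y, z) = ω(v_x, v_y, v_z)|_p` on `𝔤`. -/
def omegaThree (P : TwoPlectic E M) (v : 𝔤 →ₗ⁅ℝ⁆ SmoothVF E M) (p : M) : 𝔤 [⋀^Fin 3]→ₗ[ℝ] ℝ :=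
  ({ toFun := fun f => f p, map_add' := fun _ _ => rfl, map_smul' := fun _ _ => rfl } :
    SmoothFun E M →ₗ[ℝ] ℝ).compAlternatingMap (P.triple.compLinearMap (v : 𝔤 →ₗ[ℝ] SmoothVF E M))

/-- `-ω_{3p}` regarded as a 3-cochain on `𝔤 ⊕ H1`, by composing with the projection to `𝔤`. -/
def HamLift.negOmegaThree {P : TwoPlectic E M} {v : 𝔤 →ₗ⁅ℝ⁆ SmoothVF E M} (α : HamLift P v)
    (hB : α.B ∈ twoCocycle ℝ 𝔤 (H1 E M)) (p : M) : (α.extension hB).L [⋀^Fin 3]→ₗ[ℝ] ℝ :=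
  -(omegaThree P v p).compLinearMap ((α.extension hB).proj : (α.extension hB).L →ₗ[ℝ] 𝔤)

/-- The action of `𝔤 ⊕ H1` on `M` through the projection to `𝔤`. -/
def HamLift.action {P : TwoPlectic E M} {v : 𝔤 →ₗ⁅ℝ⁆ SmoothVF E M} (α : HamLift P v)
    (hB : α.B ∈ twoCocycle ℝ 𝔤 (H1 E M)) : (α.extension hB).L →ₗ⁅ℝ⁆ SmoothVF E M :=
  v.comp (α.extension hB).proj
end MomentMaps

end Multisymplectic

end

open Multisymplectic LieModule.Cohomology

/-!
The forms `D(x, y) = α_[x, y] - ι(v_x ∧ v_y) ω` measure how far a linear choice `α` of Hamiltonian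
1-forms is from respecting brackets. Everything rests on one identity, `HamLift.defect_cyclic`: the
sum `D(x, [y, z]) - D(y, [x, z]) + D(z, [x, y])` is `d (ω(v_x, v_y, v_z))`, since the `α`-terms
cancel by the Jacobi identity and the contractions of `ω` sum to that differential. Passing to
cohomology, `B = [D]` is a 2-cocycle, and changing `α` changes it by the coboundary of
`x ↦ [α_x - α'_x]`, which yields the isomorphism `HamLift.extensionEquiv` of extensions.

Once a linear map `ψ` of representatives is fixed, the forms `D(x, y) - ψ(B(x, y))` are exact. On a
connected manifold a function is determined by its differential and its value at `p`
(`eq_of_dFun_eq`), so these forms have primitives vanishing at `p` that depend linearly on them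
(`exists_linear_primitive`). Such primitives give the component `F₂`. The binary relation for an
`L_∞`-morphism is the definition of `F₂`; in the ternary relation both sides have the same
differential by the identity above, and both vanish at `p` because the ternary bracket of the source
is `-ω_{3p}`. The same principle gives uniqueness (`HamLift.existsUnique_momentMap`).
-/

namespace Multisymplectic

/-! ### Functions with prescribed differential -/

section Primitive
variable {E : Type*} [NormedAddCommGroup E] [NormedSpace ℝ E] [CompleteSpace E]
  {M : Type*} [TopologicalSpace M] [ChartedSpace E M] [IsManifold 𝓘(ℝ, E) ∞ M]

lemma fderiv_comp_extChartAt_symm_eq_zero {f : SmoothFun E M} (hf : dFun (E := E) f = 0) (x : M)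
    {y : E} (hy : y ∈ (extChartAt 𝓘(ℝ, E) x).target) :
    fderiv ℝ (f ∘ (extChartAt 𝓘(ℝ, E) x).symm) y = 0 := by
  have h := chartRep_dFun f x hy
  rw [hf, extDeriv_constOfIsEmpty] at h
  ext w
  exact (congrArg (fun η : E [⋀^Fin 1]→L[ℝ] ℝ => η ![w]) h).symm

lemma isLocallyConstant_of_dFun_eq_zero {f : SmoothFun E M} (hf : dFun (E := E) f = 0) :
    IsLocallyConstant f := by
  refine (IsLocallyConstant.iff_eventually_eq _).2 fun x => ?_
  obtain ⟨r, hr, hball⟩ := Metric.mem_nhds_iff.1 (chart_target_mem (E := E) x)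
  have hd : DifferentiableOn ℝ (f ∘ (extChartAt 𝓘(ℝ, E) x).symm)
      (Metric.ball (extChartAt 𝓘(ℝ, E) x x) r) := fun y hy =>
    ((f.contMDiff.contMDiffAt.comp y
      (contMDiffAt_symm x (hball hy))).contDiffAt.differentiableAt (by simp)).differentiableWithinAt
  filter_upwards [extChartAt_source_mem_nhds (I := 𝓘(ℝ, E)) x,
    (continuousAt_extChartAt (I := 𝓘(ℝ, E)) x).eventually_mem (Metric.ball_mem_nhds _ hr)]
    with z hz hzb
  have h := Metric.isOpen_ball.is_const_of_fderiv_eq_zero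
    (convex_ball (extChartAt 𝓘(ℝ, E) x x) r).isPreconnected hd
    (fun y hy => fderiv_comp_extChartAt_symm_eq_zero hf x (hball hy)) hzb
    (Metric.mem_ball_self hr)
  simpa only [Function.comp_apply, (extChartAt 𝓘(ℝ, E) x).left_inv hz, extChartAt_to_inv] using h

lemma dClosed_eq_iff {f : SmoothFun E M} {β : ClosedForms E M} :
    dClosed E M f = β ↔ dFun (E := E) f = β.1 := Subtype.ext_iff

/-- On a connected manifold a function is determined by its differential and one value. -/
lemma eq_of_dFun_eq [PreconnectedSpace M] {f g : SmoothFun E M}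
    (h : dFun (E := E) f = dFun (E := E) g) {p : M} (hp : f p = g p) : f = g := by
  have hd : dFun (E := E) (f - g : SmoothFun E M) = 0 :=
    dClosed_eq_iff (β := 0).1 (by
      rw [map_sub, sub_eq_zero]
      exact Subtype.ext h)
  ext q
  have hq := (isLocallyConstant_of_dFun_eq_zero hd).apply_eq_of_preconnectedSpace q p
  change f q - g q = f p - g p at hq
  rwa [hp, sub_self, sub_eq_zero] at hq

lemma dFun_const (c : ℝ) : dFun (E := E) (ContMDiffMap.const c : SmoothFun E M) = 0 := by
  funext x
  ext m
  have h : fderiv ℝ ((ContMDiffMap.const c : SmoothFun E M) ∘ (extChartAt 𝓘(ℝ, E) x).symm)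
      (extChartAt 𝓘(ℝ, E) x x) = 0 := fderiv_const_apply c
  rw [dFun_eq_fderiv, h]
  rfl

variable (E M) in
/-- Evaluation of smooth functions at a point, as a linear form. -/
noncomputable def evalAt (p : M) : SmoothFun E M →ₗ[ℝ] ℝ where
  toFun f := f p
  map_add' _ _ := rfl
  map_smul' _ _ := rfl

lemma H1.mk_eq_zero_iff {β : ClosedForms E M} : H1.mk β = 0 ↔ ∃ f, dClosed E M f = β :=
  Submodule.Quotient.mk_eq_zero _

lemma H1.mk_surjective : Function.Surjective (H1.mk : ClosedForms E M →ₗ[ℝ] H1 E M) :=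
  Submodule.mkQ_surjective _

/-- Primitives of exact 1-forms that vanish at a base point can be chosen by a linear map, because
`d` is injective on the functions vanishing there. On closed forms that are not exact the map is an
arbitrary linear extension. -/
lemma exists_linear_primitive [PreconnectedSpace M] (p : M) :
    ∃ I : ClosedForms E M →ₗ[ℝ] SmoothFun E M,
      ∀ β, H1.mk β = 0 → dFun (E := E) (I β) = β.1 ∧ I β p = 0 := by
  obtain ⟨I, hI⟩ := LinearMap.exists_leftInverse_of_injective
    (dClosed E M ∘ₗ (LinearMap.ker (evalAt E M p)).subtype)
    (LinearMap.ker_eq_bot.2 fun f g h => Subtype.ext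
      (eq_of_dFun_eq (p := p) (congrArg Subtype.val h) (f.2.trans g.2.symm)))
  refine ⟨(LinearMap.ker (evalAt E M p)).subtype ∘ₗ I, fun β hβ => ⟨?_, (I β).2⟩⟩
  obtain ⟨f, rfl⟩ := H1.mk_eq_zero_iff.1 hβ
  have hc : dClosed E M (ContMDiffMap.const (f p)) = 0 := dClosed_eq_iff.2 (dFun_const _)
  -- Subtracting the value at `p` turns any primitive into one on which `I` inverts `d`.
  set f₀ : LinearMap.ker (evalAt E M p) :=
    ⟨f - ContMDiffMap.const (f p), sub_self (f p)⟩
  have h₀ : dClosed E M f₀ = dClosed E M f := by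
    change dClosed E M (f - ContMDiffMap.const (f p)) = _
    rw [map_sub, hc, sub_zero]
  have h₁ : I (dClosed E M f) = f₀ := by
    rw [← h₀]
    exact LinearMap.congr_fun hI f₀
  rw [LinearMap.comp_apply, h₁]
  exact congrArg Subtype.val h₀

lemma exists_linear_representatives :
    ∃ ψ : H1 E M →ₗ[ℝ] ClosedForms E M, ∀ A, H1.mk (ψ A) = A := by
  obtain ⟨ψ, hψ⟩ := (H1.mk (E := E) (M := M)).exists_rightInverse_of_surjective
    (LinearMap.range_eq_top.2 H1.mk_surjective)
  exact ⟨ψ, fun A => LinearMap.congr_fun hψ A⟩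
end Primitive

/-! ### The extension of `𝔤` by `H1` and the cocycle `ω_{3p}` -/

section Cocycles
variable {E : Type*} [NormedAddCommGroup E] [NormedSpace ℝ E] [CompleteSpace E]
  {M : Type*} [TopologicalSpace M] [ChartedSpace E M] [IsManifold 𝓘(ℝ, E) ∞ M]
  {𝔤 : Type*} [LieRing 𝔤] [LieAlgebra ℝ 𝔤]

instance : LieModule.IsTrivial 𝔤 (H1 E M) := ⟨fun _ _ => rfl⟩

lemma TwoPlectic.closedForms_le_ham (P : TwoPlectic E M) : ClosedForms E M ≤ P.Ham := by
  refine fun β hβ => ⟨hβ.1, 0, ?_⟩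
  unfold Generates
  rw [hβ.2, contract_zero_left, neg_zero]

namespace HamLift
variable {P : TwoPlectic E M} {v : 𝔤 →ₗ⁅ℝ⁆ SmoothVF E M}

/-- Hamiltonian 1-forms can be chosen linearly: the map `v` takes values in the image of the
linear map `P.hamVF`, and a vector space is projective. -/
lemma nonempty (hv : ∀ x, P.IsHamVF (v x)) : Nonempty (HamLift P v) := by
  have hmem : ∀ x, v x ∈ LinearMap.range P.hamVF := fun x => by
    obtain ⟨β, hβ, h⟩ := hv x
    exact ⟨⟨β, hβ, v x, h⟩, P.hamVF_eq h⟩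
  obtain ⟨a, ha⟩ := Module.projective_lifting_property P.hamVF.rangeRestrict
    ((v : 𝔤 →ₗ[ℝ] SmoothVF E M).codRestrict _ hmem) P.hamVF.surjective_rangeRestrict
  refine ⟨⟨a, fun x => ?_⟩⟩
  have h : P.hamVF (a x) = v x := congrArg Subtype.val (LinearMap.congr_fun ha x)
  rw [← h]
  exact P.hamVF_spec _

variable (α : HamLift P v)

lemma hamVF_toLin (x : 𝔤) : P.hamVF (α.toLin x) = v x := P.hamVF_eq (α.generates x)

lemma defect_coe (x y : 𝔤) : (α.defect x y : RawForm E M 1) =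
    (α.toLin ⁅x, y⁆ : RawForm E M 1) - contract (v y) (contract (v x) P.form) := rfl

lemma B_apply (x y : 𝔤) : α.B x y = H1.mk (α.defect x y) := rfl

/-- The cyclic sum of the defect is exact. Its terms `α_[x, [y, z]]` cancel by the Jacobi identity,
and the remaining contractions add up to the differential of `ω(v_x, v_y, v_z)`. -/
lemma defect_cyclic (x y z : 𝔤) :
    α.defect x ⁅y, z⁆ - α.defect y ⁅x, z⁆ + α.defect z ⁅x, y⁆ =
      dClosed E M (P.triple ![v x, v y, v z]) := by
  have hJ : α.toLin ⁅x, ⁅y, z⁆⁆ - α.toLin ⁅y, ⁅x, z⁆⁆ + α.toLin ⁅z, ⁅x, y⁆⁆ = 0 := by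
    rw [← map_sub, ← map_add, leibniz_lie x y z, ← lie_skew z ⁅x, y⁆]
    simp
  have hJ' := congrArg Subtype.val hJ
  have hs : (⁅v z, v x⁆ : SmoothVF E M) = (-1 : ℝ) • ⁅v x, v z⁆ := by rw [neg_one_smul, lie_skew]
  refine Subtype.ext ?_
  change (_ - _) - (_ - _) + (_ - _) = dFun _
  change (α.toLin ⁅x, ⁅y, z⁆⁆ : RawForm E M 1) - (α.toLin ⁅y, ⁅x, z⁆⁆ : RawForm E M 1)
    + (α.toLin ⁅z, ⁅x, y⁆⁆ : RawForm E M 1) = 0 at hJ'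
  rw [P.dFun_triple (α.isHamVF x) (α.isHamVF y) (α.isHamVF z), hs, contract_smul_left,
    neg_one_smul, LieHom.map_lie, LieHom.map_lie, LieHom.map_lie, ← sub_eq_zero]
  rw [← hJ']
  abel

lemma B_cyclic (x y z : 𝔤) : α.B x ⁅y, z⁆ - α.B y ⁅x, z⁆ + α.B z ⁅x, y⁆ = 0 := by
  rw [B_apply, B_apply, B_apply, ← map_sub, ← map_add, defect_cyclic]
  exact H1.mk_eq_zero_iff.2 ⟨_, rfl⟩

lemma B_mem_twoCocycle : α.B ∈ twoCocycle ℝ 𝔤 (H1 E M) := by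
  refine (mem_twoCocycle_iff_of_trivial ℝ 𝔤 _ _).2 fun x y z => ?_
  have h := α.B_cyclic x y z
  rw [← twoCochain_skew α.B ⁅x, y⁆ z] at h
  rw [← sub_eq_zero, ← h]
  abel

lemma B_sub_B (α' : HamLift P v) : α.B - α'.B = -d₁₂ ℝ 𝔤 _ (α.diff α') := by
  refine Subtype.ext (LinearMap.ext₂ fun x y => ?_)
  change H1.mk (α.defect x y) - H1.mk (α'.defect x y) = -(d₁₂ ℝ 𝔤 _ (α.diff α') x y)
  rw [d₁₂_apply_apply_ofTrivial, neg_neg, ← map_sub]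
  refine congrArg H1.mk (Subtype.ext ?_)
  change (_ - _) - (_ - _) = (α.toLin ⁅x, y⁆ : RawForm E M 1) - (α'.toLin ⁅x, y⁆ : RawForm E M 1)
  abel

section Extension
variable (hB : α.B ∈ twoCocycle ℝ 𝔤 (H1 E M))

lemma lie_pair (x₁ : 𝔤) (A₁ : H1 E M) (x₂ : 𝔤) (A₂ : H1 E M) :
    ⁅α.pair hB x₁ A₁, α.pair hB x₂ A₂⁆ = α.pair hB ⁅x₁, x₂⁆ (α.B x₁ x₂) := by
  change α.pair hB ⁅x₁, x₂⁆ (α.B x₁ x₂ + 0 - 0) = _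
  rw [add_zero, sub_zero]

lemma lie_incl (A : H1 E M) (z : (α.extension hB).L) : ⁅(α.extension hB).incl A, z⁆ = 0 := by
  obtain ⟨⟨x, A'⟩⟩ := z
  refine (α.lie_pair hB 0 A x A').trans ?_
  rw [zero_lie, map_zero]
  rfl

lemma B_eq_add (α' : HamLift P v) : α'.B = α.B + d₁₂ ℝ 𝔤 _ (α.diff α') := by
  refine Subtype.ext (LinearMap.ext₂ fun x y => ?_)
  have k : α.B x y - α'.B x y = -(d₁₂ ℝ 𝔤 _ (α.diff α') x y) :=
    congrArg (fun b : twoCochain ℝ 𝔤 (H1 E M) => b x y) (α.B_sub_B α')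
  change α'.B x y = α.B x y + d₁₂ ℝ 𝔤 _ (α.diff α') x y
  rw [← neg_neg (d₁₂ ℝ 𝔤 _ (α.diff α') x y), ← k]
  abel

/-- Two choices of Hamiltonian forms give isomorphic extensions, by the shear
`(x, A) ↦ (x, A - [α_x - α'_x])`. -/
noncomputable def extensionEquiv (α' : HamLift P v) (hB' : α'.B ∈ twoCocycle ℝ 𝔤 (H1 E M)) :
    (α.extension hB).L ≃ₗ⁅ℝ⁆ (α'.extension hB').L :=
  LieAlgebra.LieEquiv.ofCoboundary (⟨α.B, hB⟩ : twoCocycle ℝ 𝔤 (H1 E M)) ⟨α'.B, hB'⟩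
    (α.diff α') (α.B_eq_add α')

lemma extensionEquiv_pair (α' : HamLift P v) (hB' : α'.B ∈ twoCocycle ℝ 𝔤 (H1 E M)) (x : 𝔤)
    (A : H1 E M) :
    α.extensionEquiv hB α' hB' (α.pair hB x A) = α'.pair hB' x (A - α.diff α' x) := rfl

lemma extensionEquiv_incl (α' : HamLift P v) (hB' : α'.B ∈ twoCocycle ℝ 𝔤 (H1 E M))
    (A : H1 E M) :
    α.extensionEquiv hB α' hB' ((α.extension hB).incl A) = (α'.extension hB').incl A := by
  refine (α.extensionEquiv_pair hB α' hB' 0 A).trans ?_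
  rw [map_zero, sub_zero]
  rfl

lemma proj_extensionEquiv (α' : HamLift P v) (hB' : α'.B ∈ twoCocycle ℝ 𝔤 (H1 E M))
    (z : (α.extension hB).L) :
    (α'.extension hB').proj (α.extensionEquiv hB α' hB' z) = (α.extension hB).proj z := by
  obtain ⟨⟨x, A⟩⟩ := z
  refine (congrArg (α'.extension hB').proj (α.extensionEquiv_pair hB α' hB' x A)).trans ?_
  rfl
end Extension
end HamLift

lemma omegaThree_apply (P : TwoPlectic E M) (v : 𝔤 →ₗ⁅ℝ⁆ SmoothVF E M) (p : M) (x y z : 𝔤) :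
    omegaThree P v p ![x, y, z] = P.triple ![v x, v y, v z] p := by
  change P.triple _ p = _
  congr 2
  ext i : 1
  fin_cases i <;> rfl

lemma isThreeCocycle_omegaThree {P : TwoPlectic E M} {v : 𝔤 →ₗ⁅ℝ⁆ SmoothVF E M}
    (hv : ∀ x, P.IsHamVF (v x)) (p : M) : IsThreeCocycle (omegaThree P v p) := by
  intro x y z u
  have h := congrArg (evalAt E M p) (P.triple_coherence (hv x) (hv y) (hv z) (hv u))
  simp only [map_add, map_sub, map_zero] at h
  simp only [omegaThree_apply, LieHom.map_lie]
  simp only [evalAt, LinearMap.coe_mk, AddHom.coe_mk] at h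
  linarith

lemma HamLift.negOmegaThree_apply {P : TwoPlectic E M} {v : 𝔤 →ₗ⁅ℝ⁆ SmoothVF E M}
    (α : HamLift P v) (hB : α.B ∈ twoCocycle ℝ 𝔤 (H1 E M)) (p : M) (x y z : (α.extension hB).L) :
    α.negOmegaThree hB p ![x, y, z] = -omegaThree P v p
      ![(α.extension hB).proj x, (α.extension hB).proj y, (α.extension hB).proj z] := by
  change -(omegaThree P v p _) = _
  congr 2
  ext i : 1
  fin_cases i <;> rfl

lemma HamLift.isThreeCocycle_negOmegaThree {P : TwoPlectic E M} {v : 𝔤 →ₗ⁅ℝ⁆ SmoothVF E M}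
    (α : HamLift P v) (hB : α.B ∈ twoCocycle ℝ 𝔤 (H1 E M)) (p : M) :
    IsThreeCocycle (α.negOmegaThree hB p) := by
  intro x y z u
  have h := isThreeCocycle_omegaThree α.isHamVF p ((α.extension hB).proj x)
    ((α.extension hB).proj y) ((α.extension hB).proj z) ((α.extension hB).proj u)
  simp only [negOmegaThree_apply, LieHom.map_lie]
  linarith
end Cocycles

/-! ### The moment map -/

section MomentMap
variable {E : Type*} [NormedAddCommGroup E] [NormedSpace ℝ E] [CompleteSpace E]
  {M : Type*} [TopologicalSpace M] [ChartedSpace E M] [IsManifold 𝓘(ℝ, E) ∞ M]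
  {𝔤 : Type*} [LieRing 𝔤] [LieAlgebra ℝ 𝔤]

namespace HamLift
variable {P : TwoPlectic E M} {v : 𝔤 →ₗ⁅ℝ⁆ SmoothVF E M} (α : HamLift P v)
  (ψ : H1 E M →ₗ[ℝ] ClosedForms E M)

/-- The form `α_[x, y] - ι(v_x ∧ v_y) ω - ψ(B(x, y))`, which is exact when `ψ` assigns to each
class a representative. -/
noncomputable def exactDefect : 𝔤 →ₗ[ℝ] 𝔤 →ₗ[ℝ] ClosedForms E M :=
  α.defect - α.B.1.compr₂ ψ

lemma exactDefect_apply (x y : 𝔤) : α.exactDefect ψ x y = α.defect x y - ψ (α.B x y) := rfl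

lemma exactDefect_self (x : 𝔤) : α.exactDefect ψ x x = 0 := by
  have h : α.defect x x = 0 := Subtype.ext (by
    have hb := congrArg Subtype.val (P.observables.br_self (α.toLin x))
    change contract (P.hamVF (α.toLin x)) (contract (P.hamVF (α.toLin x)) P.form) = 0 at hb
    rw [hamVF_toLin] at hb
    rw [defect_coe, lie_self, map_zero, hb]
    exact sub_zero _)
  rw [exactDefect_apply, h, twoCochain_alt, map_zero, sub_zero]

variable {ψ} in
lemma mk_exactDefect (hψ : ∀ A, H1.mk (ψ A) = A) (x y : 𝔤) :
    H1.mk (α.exactDefect ψ x y) = 0 := by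
  rw [exactDefect_apply, map_sub, hψ, B_apply, sub_self]

lemma exactDefect_cyclic (x y z : 𝔤) :
    α.exactDefect ψ x ⁅y, z⁆ - α.exactDefect ψ y ⁅x, z⁆ + α.exactDefect ψ z ⁅x, y⁆ =
      dClosed E M (P.triple ![v x, v y, v z]) := by
  have h := congrArg ψ (α.B_cyclic x y z)
  rw [map_add, map_sub, map_zero] at h
  rw [← defect_cyclic, exactDefect_apply, exactDefect_apply, exactDefect_apply, ← sub_zero
    (α.defect x ⁅y, z⁆ - α.defect y ⁅x, z⁆ + α.defect z ⁅x, y⁆), ← h]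
  abel

variable (hB : α.B ∈ twoCocycle ℝ 𝔤 (H1 E M))

/-- The projection of `𝔤 ⊕ H1` to `H1`, a linear map that does not respect the brackets. -/
noncomputable def snd : (α.extension hB).L →ₗ[ℝ] H1 E M where
  toFun z := ((LieAlgebra.ofProd (⟨α.B, hB⟩ : twoCocycle ℝ 𝔤 (H1 E M))).symm z).2
  map_add' _ _ := rfl
  map_smul' _ _ := rfl

lemma snd_lie (z w : (α.extension hB).L) :
    α.snd hB ⁅z, w⁆ = α.B ((α.extension hB).proj z) ((α.extension hB).proj w) := by
  obtain ⟨⟨x, A⟩⟩ := z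
  obtain ⟨⟨y, A'⟩⟩ := w
  exact congrArg (α.snd hB) (α.lie_pair hB x A y A')

/-- The map `x + A ↦ α_x - ψ(A)` from `𝔤 ⊕ H1` to Hamiltonian 1-forms. -/
noncomputable def momentForm : (α.extension hB).L →ₗ[ℝ] P.Ham :=
  α.toLin ∘ₗ ((α.extension hB).proj : (α.extension hB).L →ₗ[ℝ] 𝔤)
    - Submodule.inclusion P.closedForms_le_ham ∘ₗ ψ ∘ₗ α.snd hB

lemma momentForm_coe (z : (α.extension hB).L) : (α.momentForm ψ hB z : RawForm E M 1) =
    (α.toLin ((α.extension hB).proj z)).1 - (ψ (α.snd hB z)).1 := rfl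

lemma generates_momentForm (z : (α.extension hB).L) :
    P.Generates (α.momentForm ψ hB z) (α.action hB z) := by
  have h := (α.generates ((α.extension hB).proj z)).add (α.toLin _).2.1
    ((-1 : ℝ) • ψ (α.snd hB z)).2.1 (W := 0) (by
      unfold TwoPlectic.Generates
      rw [((-1 : ℝ) • ψ (α.snd hB z)).2.2, contract_zero_left, neg_zero])
  rw [add_zero] at h
  rw [momentForm_coe, sub_eq_add_neg, ← neg_one_smul ℝ]
  exact h

lemma hamVF_momentForm (z : (α.extension hB).L) :
    P.hamVF (α.momentForm ψ hB z) = v ((α.extension hB).proj z) :=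
  P.hamVF_eq (α.generates_momentForm ψ hB z)

variable {ψ} in
/-- The moment map with `F₁(x + A) = α_x - ψ(A)` and `F₂` the primitive of `exactDefect` vanishing
at `p`. The ternary relation equates two functions with the same differential; they agree at `p`
because the ternary bracket of the source is `-ω_{3p}`. -/
lemma existsUnique_momentMap [PreconnectedSpace M] (hψ : ∀ A, H1.mk (ψ A) = A) (p : M)
    (hc : IsThreeCocycle (α.negOmegaThree hB p)) :
    ∃! F : LInftyHom (Lie2Algebra.ofThreeCocycle _ hc) P.observables,
      P.IsMomentMap (α.action hB) F ∧
      (∀ x A, (F.f₁ (α.pair hB x A)).1 = (α.toLin x).1 - (ψ A).1) ∧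
      (∀ (r : ℝ) (q : M), F.f₁' r q = r) ∧
      ∀ x₁ A₁ x₂ A₂,
        dFun (F.f₂ (α.pair hB x₁ A₁) (α.pair hB x₂ A₂)) =
          (α.toLin ⁅x₁, x₂⁆).1 - contract (v x₂) (contract (v x₁) P.form)
            - (ψ (α.B x₁ x₂)).1 ∧
        F.f₂ (α.pair hB x₁ A₁) (α.pair hB x₂ A₂) p = 0 := by
  obtain ⟨I, hI⟩ := exists_linear_primitive (E := E) (M := M) p
  let π : (α.extension hB).L →ₗ[ℝ] 𝔤 := ((α.extension hB).proj : (α.extension hB).L →ₗ[ℝ] 𝔤)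
  have hdI : ∀ x y, dFun (E := E) (I (α.exactDefect ψ x y)) = (α.exactDefect ψ x y).1 :=
    fun x y => (hI _ (α.mk_exactDefect hψ x y)).1
  have hpI : ∀ x y, I (α.exactDefect ψ x y) p = 0 :=
    fun x y => (hI _ (α.mk_exactDefect hψ x y)).2
  have hlie : ∀ z w : (α.extension hB).L, π ⁅z, w⁆ = ⁅π z, π w⁆ :=
    fun z w => (α.extension hB).proj.map_lie z w
  let F : LInftyHom (Lie2Algebra.ofThreeCocycle _ hc) P.observables :=
    { f₁ := α.momentForm ψ hB
      f₁' :=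
        { toFun := fun r => ContMDiffMap.const r
          map_add' := fun _ _ => rfl
          map_smul' := fun _ _ => rfl }
      f₂ := ((α.exactDefect ψ).compr₂ I).compl₁₂ π π
      f₂_self := fun z => by
        change I (α.exactDefect ψ (π z) (π z)) = 0
        rw [exactDefect_self, map_zero]
      map_δ := fun r => (Subtype.ext (dFun_const r)).trans (map_zero (α.momentForm ψ hB)).symm
      map_br := fun z w => Subtype.ext (by
        change dFun (I (α.exactDefect ψ (π z) (π w))) = (α.momentForm ψ hB ⁅z, w⁆).1
          - contract (P.hamVF (α.momentForm ψ hB w))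
            (contract (P.hamVF (α.momentForm ψ hB z)) P.form)
        rw [hdI, hamVF_momentForm, hamVF_momentForm, momentForm_coe, snd_lie, LieHom.map_lie,
          exactDefect_apply]
        change (_ - _) - _ = (_ - _) - _
        exact sub_right_comm _ _ _)
      map_act := fun z r => by
        change (((α.exactDefect ψ).compr₂ I).compl₁₂ π π z) 0 = ContMDiffMap.const 0 - 0
        rw [map_zero]
        exact (sub_zero _).symm
      map_br₃ := fun x y z => by
        have ht : P.observables.br₃
            ![α.momentForm ψ hB x, α.momentForm ψ hB y, α.momentForm ψ hB z] =
              -P.triple ![v (π x), v (π y), v (π z)] := by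
          change -(P.triple _) = _
          congr 2
          ext i : 1
          fin_cases i <;> exact α.hamVF_momentForm ψ hB _
        have hr : α.negOmegaThree hB p ![x, y, z] = -P.triple ![v (π x), v (π y), v (π z)] p := by
          rw [negOmegaThree_apply, omegaThree_apply]
          rfl
        rw [ht]
        change ContMDiffMap.const (α.negOmegaThree hB p ![x, y, z])
            - -P.triple ![v (π x), v (π y), v (π z)] =
          I (α.exactDefect ψ (π x) (π ⁅y, z⁆)) - I (α.exactDefect ψ (π y) (π ⁅x, z⁆))
            + I (α.exactDefect ψ (π z) (π ⁅x, y⁆)) + 0 - 0 + 0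
        -- Both sides vanish at `p` and have differential `d (ω(v_x, v_y, v_z))`.
        rw [hr, hlie, hlie, hlie, add_zero, sub_zero, add_zero, sub_neg_eq_add]
        refine eq_of_dFun_eq (p := p) ?_ ?_
        · have hcyc := congrArg Subtype.val (α.exactDefect_cyclic ψ (π x) (π y) (π z))
          rw [← map_sub, ← map_add, (hI _ ?_).1, dFun_add, dFun_const, zero_add, hcyc]
          · rfl
          · rw [map_add, map_sub, mk_exactDefect α hψ, mk_exactDefect α hψ,
              mk_exactDefect α hψ, sub_zero, add_zero]
        · change -P.triple ![v (π x), v (π y), v (π z)] p + P.triple ![v (π x), v (π y), v (π z)] p =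
            I (α.exactDefect ψ (π x) ⁅π y, π z⁆) p - I (α.exactDefect ψ (π y) ⁅π x, π z⁆) p
              + I (α.exactDefect ψ (π z) ⁅π x, π y⁆) p
          rw [hpI, hpI, hpI, neg_add_cancel, sub_zero, add_zero] }
  refine ⟨F, ⟨α.generates_momentForm ψ hB, fun x A => rfl, fun r q => rfl,
    fun x₁ A₁ x₂ A₂ => ⟨hdI x₁ x₂, hpI x₁ x₂⟩⟩, ?_⟩
  rintro G ⟨-, hG₁, hG₁', hG₂⟩
  -- Every element of `𝔤 ⊕ H1` is a pair, so the conditions determine all three components.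
  refine LInftyHom.ext ?_ ?_ ?_
  · refine LinearMap.ext fun ⟨⟨x, A⟩⟩ => Subtype.ext (hG₁ x A)
  · exact LinearMap.ext fun r => ContMDiffMap.ext fun q => hG₁' r q
  · refine LinearMap.ext₂ fun ⟨⟨x₁, A₁⟩⟩ ⟨⟨x₂, A₂⟩⟩ => eq_of_dFun_eq (p := p) ?_ ?_
    · exact (hG₂ x₁ A₁ x₂ A₂).1.trans (hdI x₁ x₂).symm
    · exact (hG₂ x₁ A₁ x₂ A₂).2.trans (hpI x₁ x₂).symm
end HamLift
end MomentMap

end Multisymplectic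

theorem mainTheorem11 {n : ℕ} {M : Type*} [TopologicalSpace M] [T2Space M]
    [SecondCountableTopology M] [ConnectedSpace M] [ChartedSpace (EuclideanSpace ℝ (Fin n)) M]
    [IsManifold 𝓘(ℝ, EuclideanSpace ℝ (Fin n)) ∞ M]
    (P : TwoPlectic (EuclideanSpace ℝ (Fin n)) M)
    {𝔤 : Type*} [LieRing 𝔤] [LieAlgebra ℝ 𝔤]
    (v : 𝔤 →ₗ⁅ℝ⁆ SmoothVF (EuclideanSpace ℝ (Fin n)) M) (hv : ∀ x, P.IsHamVF (v x)) :
    Nonempty (HamLift P v) ∧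
    ∃ hB : ∀ α : HamLift P v, α.B ∈ twoCocycle ℝ 𝔤 (H1 (EuclideanSpace ℝ (Fin n)) M),
      -- the cocycle defines a central extension of `𝔤`
      (∀ α : HamLift P v,
        (∀ x₁ A₁ x₂ A₂, ⁅α.pair (hB α) x₁ A₁, α.pair (hB α) x₂ A₂⁆ =
          α.pair (hB α) ⁅x₁, x₂⁆ (α.B x₁ x₂)) ∧
        ∀ A (z : (α.extension (hB α)).L), ⁅(α.extension (hB α)).incl A, z⁆ = 0) ∧
      -- which does not depend on the choices, up to isomorphism of extensions
      (∀ α α' : HamLift P v, α.B - α'.B = -d₁₂ ℝ 𝔤 _ (α.diff α') ∧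
        ∃ e : (α.extension (hB α)).L ≃ₗ⁅ℝ⁆ (α'.extension (hB α')).L,
          (∀ A, e ((α.extension (hB α)).incl A) = (α'.extension (hB α')).incl A) ∧
          ∀ z, (α'.extension (hB α')).proj (e z) = (α.extension (hB α)).proj z) ∧
      -- and the associated Lie 2-algebra has a moment map
      ∀ p : M, IsThreeCocycle (omegaThree P v p) ∧
        ∃ hc : ∀ α : HamLift P v, IsThreeCocycle (α.negOmegaThree (hB α) p),
          ∀ α : HamLift P v,
            (∃ F : LInftyHom (Lie2Algebra.ofThreeCocycle _ (hc α)) P.observables,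
              P.IsMomentMap (α.action (hB α)) F) ∧
            -- given explicitly in terms of a linear choice of representatives
            (∃ ψ : H1 (EuclideanSpace ℝ (Fin n)) M →ₗ[ℝ] ClosedForms (EuclideanSpace ℝ (Fin n)) M,
              ∀ A, H1.mk (ψ A) = A) ∧
            ∀ ψ : H1 (EuclideanSpace ℝ (Fin n)) M →ₗ[ℝ] ClosedForms (EuclideanSpace ℝ (Fin n)) M,
              (∀ A, H1.mk (ψ A) = A) →
              ∃! F : LInftyHom (Lie2Algebra.ofThreeCocycle _ (hc α)) P.observables,
                P.IsMomentMap (α.action (hB α)) F ∧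
                (∀ x A, (F.f₁ (α.pair (hB α) x A)).1 = (α.toLin x).1 - (ψ A).1) ∧
                (∀ (r : ℝ) (q : M), F.f₁' r q = r) ∧
                ∀ x₁ A₁ x₂ A₂,
                  dFun (F.f₂ (α.pair (hB α) x₁ A₁) (α.pair (hB α) x₂ A₂)) =
                    (α.toLin ⁅x₁, x₂⁆).1 - contract (v x₂) (contract (v x₁) P.form)
                      - (ψ (α.B x₁ x₂)).1 ∧
                  F.f₂ (α.pair (hB α) x₁ A₁) (α.pair (hB α) x₂ A₂) p = 0 := by
  refine ⟨HamLift.nonempty hv, fun α => α.B_mem_twoCocycle, fun α => ⟨α.lie_pair _, α.lie_incl _⟩,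
    fun α α' => ⟨α.B_sub_B α', α.extensionEquiv _ α' _, α.extensionEquiv_incl _ α' _,
      α.proj_extensionEquiv _ α' _⟩, fun p =>
    ⟨isThreeCocycle_omegaThree hv p, fun α => α.isThreeCocycle_negOmegaThree _ p, fun α => ?_⟩⟩
  obtain ⟨ψ, hψ⟩ := exists_linear_representatives (E := EuclideanSpace ℝ (Fin n)) (M := M)
  obtain ⟨F, ⟨hF, -⟩, -⟩ := α.existsUnique_momentMap α.B_mem_twoCocycle hψ p
    (α.isThreeCocycle_negOmegaThree _ p)
  exact ⟨⟨F, hF⟩, ⟨ψ, hψ⟩, fun ψ hψ => α.existsUnique_momentMap _ hψ p _⟩
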